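/- Setting. Let $(M',g)$ be a Riemannian manifold and $M\subset M'$ compact (in the application $M'$ is an exact symplectic manifold with compatible metric $g$, and $M$ is a compact domain with smooth boundary). Let $M\subset W\subset M'$ and $\rho>0$ be such that any two points of $M$ at distance less than $\rho$ are joined by a unique minimal geodesic of $M'$, and this geodesic lies in $W$ (if $W$ is a neighbourhood of $M$, such a $\rho$ exists by compactness; if $M$ is locally geodesically convex one may take $W=M$). For $\beta>0$ and $r\ge 1$ put $$\Lambda_{r,\beta}M=\Bigl\{\vec z_1=(z_{1,j})_{j\in\mathbb Z_r}\in M^r \;\Big|\; r\sum_j \operatorname{dist}(z_{1,j},z_{1,j+1})^2<\beta\Bigr\}.$$ Let $\Lambda W$ be the space of continuous, piecewise smooth loops $\mathbb R/\mathbb Z\to W$, with the topology of uniform convergence together with convergence of the energy $e(\gamma)=\int\|\gamma'\|^2$. Let $\mathcal L(k)$ be the Grassmannian of Lagrangian subspaces of $(\mathbb R^{2k},\omega_0)$, with its metric induced from the Grassmannian. A section $S_{\mathcal L}$ of loops of Lagrangian subspaces of $TM'\times\mathbb R^{2k}$ is of product type if it depends only on the loop in $M'$ and splits as a direct sum of a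 loop of Lagrangian subspaces of $TM'$ and a loop $S(\gamma)\in\Lambda\mathcal L(k)$. The forms below depend only on the second factor $S$, of which we assume: on the set of loops $\gamma\in\Lambda W$ with $e(\gamma)<\beta$, $S$ is continuous (for uniform convergence in the target), the loops $S(\gamma)$ are piecewise smooth, and $e(S(\gamma))<C$ for a constant $C$. Write points of $\mathbb R^{2k}$ as $(x,y)$, let $\lambda_0=\sum_i y_i\,dx_i$ and $J(x,y)=(-y,x)$. For a Hamiltonian $H$ on $\mathbb R^{2k}$ let $\varphi_t$ be the flow of $X_H=-J\nabla H$. For Lagrangian subspaces $L_j$, $j\in\mathbb Z_r$, and $\vec z=(z_j)\in(\mathbb R^{2k})^r$, the finite reduction is $$A_{r,H}(\vec z)=\sum_{j\in\mathbb Z_r}\Bigl(\int_{\gamma_j}(\lambda_0-H\,dt)+\int_{\gamma^{\llcorner}_j}\lambda_0\Bigr),$$ where $\gamma_j(t)=\varphi_t(z_j)$ for $0\le t\le 1/r$, $z_j^-=\varphi_{1/r}(z_{j-1})$, and $\gamma_j^{\llcorner}$ runs straight from $z_j^-$ to $z_j+\mathrm{pr}_{L_j}(z_j^--z_j)$ and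 then straight to $z_j$ ($\mathrm{pr}_L$ denotes the orthogonal projection onto $L$). For $\vec z_1\in\Lambda_{r,\beta}M$ let $\gamma_{\vec z_1}$ be the closed piecewise geodesic with $\gamma_{\vec z_1}(j/r)=z_{1,j}$ (for large $r$ it is well defined), and $L_j=S(\gamma_{\vec z_1})(j/r)$. Let $A_r^D(\vec z_1,-)$ and $B_r^D(\vec z_1,-)$ be the resulting quadratic forms on $(\mathbb R^{2k})^r$ for $H=H_D=\|z\|^2$ and for $H=0$ respectively. Let $\zeta$ and $\zeta_B$ be the families over $\Lambda_{r,\beta}M$ whose fibre at $\vec z_1$ is the negative eigenspace (the span of the eigenvectors with negative eigenvalue of the Hessian) of $A_r^D(\vec z_1,-)$ and of $B_r^D(\vec z_1,-)$, topologized as subspaces of $\Lambda_{r,\beta}M\times(\mathbb R^{2k})^r$. Statement. There is an $r_0$, which does not depend on $S$, such that for all $r\ge r_0$ the piecewise geodesics $\gamma_{\vec z_1}$ in $\Lambda W$ exist and are unique and, for every $S$ as above, $\zeta$ and $\zeta_B$ are (locally trivial) vector bundles over $\Lambda_{r,\beta}M$ and $$\zeta\;\cong\;\zeta_B\oplus\mathbb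 R^{2k}$$ as vector bundles, where $\mathbb R^{2k}$ is the trivial bundle. -/

import Mathlib

open Set Filter Topology MeasureTheory Manifold Bundle
open scoped ENNReal NNReal ContDiff

noncomputable section

namespace FiniteReduction

/-! ### Linear symplectic geometry of `ℝ^{2k}` -/

/-- The standard Euclidean space `ℝ^{2k}`. The coordinates of `z = (x, y)` are
`x i = z (Sum.inl i)` and `y i = z (Sum.inr i)`. -/
abbrev V (k : ℕ) : Type := EuclideanSpace ℝ (Fin k ⊕ Fin k)

/-- The standard complex structure `J (x, y) = (-y, x)`. -/
def J {k : ℕ} (z : V k) : V k :=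
  WithLp.toLp 2 (Sum.elim (fun i => -z (Sum.inr i)) (fun i => z (Sum.inl i)))

/-- The canonical one-form `λ₀ = ∑ y_i dx_i`, at the point `z`, on the vector `v`. -/
def lam {k : ℕ} (z v : V k) : ℝ := ∑ i, z (Sum.inr i) * v (Sum.inl i)

/-- The standard symplectic form, up to its sign, which plays no role for Lagrangian subspaces. -/
def omega {k : ℕ} (u v : V k) : ℝ :=
  ∑ i, (u (Sum.inl i) * v (Sum.inr i) - u (Sum.inr i) * v (Sum.inl i))

/-- Lagrangian subspaces: isotropic of dimension `k`. -/
def IsLagrangian {k : ℕ} (L : Submodule ℝ (V k)) : Prop :=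
  (∀ u ∈ L, ∀ v ∈ L, omega u v = 0) ∧ Module.finrank ℝ L = k

/-- The Grassmannian `𝓛(k)` of Lagrangian subspaces of `ℝ^{2k}`. -/
def Lagr (k : ℕ) : Type := {L : Submodule ℝ (V k) // IsLagrangian L}

/-- The orthogonal projection onto a Lagrangian subspace. -/
def Lagr.proj {k : ℕ} (L : Lagr k) : V k →L[ℝ] V k := L.1.starProjection

/-- The topology of `𝓛(k)`, as a subspace of the space of orthogonal projections. -/
instance (k : ℕ) : TopologicalSpace (Lagr k) :=
  TopologicalSpace.induced Lagr.proj inferInstance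

/-! ### The finite reduction of the action integral on `ℝ^{2k}` -/

/-- The Hamiltonian vector field `X_H = -J ∇H`. -/
def hamVF {k : ℕ} (H : V k → ℝ) (z : V k) : V k := -J (gradient H z)

/-- `φ` is the Hamiltonian flow of `H`. -/
def IsHamFlow {k : ℕ} (H : V k → ℝ) (φ : ℝ → V k → V k) : Prop :=
  ∀ z, φ 0 z = z ∧ ∀ t, HasDerivAt (fun u => φ u z) (hamVF H (φ t z)) t

/-- The Hamiltonian `H_D(z) = ‖z‖²`. -/
def HD {k : ℕ} (z : V k) : ℝ := ‖z‖ ^ 2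

/-- The Hamiltonian flow of `H_D`: the rotation `(x, y) ↦ e^{-2it}(x + iy)`. -/
def flowHD {k : ℕ} (t : ℝ) (z : V k) : V k := Real.cos (2 * t) • z - Real.sin (2 * t) • J z

theorem gradient_HD {k : ℕ} (z : V k) : gradient (HD (k := k)) z = (2 : ℝ) • z := by
  apply HasGradientAt.gradient
  rw [hasGradientAt_iff_hasFDerivAt]
  refine (hasStrictFDerivAt_norm_sq z).hasFDerivAt.congr_fderiv ?_
  ext v
  simp [two_smul]

/-- The rotation `flowHD` is the Hamiltonian flow of `H_D`. -/
theorem isHamFlow_flowHD {k : ℕ} : IsHamFlow (HD (k := k)) flowHD := by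
  intro z
  refine ⟨by simp [flowHD], fun t => ?_⟩
  have h2 : HasDerivAt (fun u : ℝ => 2 * u) 2 t := by
    simpa using (hasDerivAt_id t).const_mul (2 : ℝ)
  have h := (h2.cos.smul_const z).sub (h2.sin.smul_const (J z))
  refine h.congr_deriv ?_
  unfold hamVF
  rw [gradient_HD]
  ext i
  cases i <;> simp [flowHD, J] <;> ring

/-- The constant flow is the Hamiltonian flow of the Hamiltonian `0`. -/
theorem isHamFlow_zero {k : ℕ} : IsHamFlow (fun _ : V k => (0 : ℝ)) (fun _ z => z) := by
  intro z
  refine ⟨rfl, fun t => ?_⟩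
  have h : hamVF (fun _ : V k => (0 : ℝ)) z = 0 := by
    ext i
    cases i <;> simp [hamVF, J]
  simpa only [h] using hasDerivAt_const t z

/-- The line integral `∫_c λ₀` along the curve `c : [a, b] → ℝ^{2k}`. -/
def lineIntegral {k : ℕ} (c : ℝ → V k) (a b : ℝ) : ℝ := ∫ t in a..b, lam (c t) (deriv c t)

/-- The integral of `λ₀` along the `L`-curve from `w` to `z`: with `w - z = u_L + u_{L^⊥}`, the
curve runs along a straight segment from `w` to the corner `z' = z + u_L`, and then along a
straight segment (in a direction of `L`) from `z'` to `z`. -/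
def wedgeIntegral {k : ℕ} (w z : V k) (L : Lagr k) : ℝ :=
  let z' := z + L.proj (w - z)
  lineIntegral (fun t => AffineMap.lineMap w z' t) 0 1 +
    lineIntegral (fun t => AffineMap.lineMap z' z t) 0 1

/-- The finite reduction of the action integral on `ℝ^{2k}`, for a Hamiltonian `H` with flow `φ`
and Lagrangian subspaces `L j`. -/
def finRed {k r : ℕ} [NeZero r] (H : V k → ℝ) (φ : ℝ → V k → V k) (L : ZMod r → Lagr k)
    (z : ZMod r → V k) : ℝ :=
  ∑ j : ZMod r,
    ((lineIntegral (fun t => φ t (z j)) 0 (1 / (r : ℝ))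
        - ∫ t in (0 : ℝ)..(1 / (r : ℝ)), H (φ t (z j)))
      + wedgeIntegral (φ (1 / (r : ℝ)) (z (j - 1))) (z j) (L j))

/-- The space `(ℝ^{2k})^r` with the product Euclidean structure. -/
abbrev VR (k r : ℕ) : Type := PiLp 2 (fun _ : ZMod r => V k)

/-- The form `A_r^D`, with Hamiltonian `H_D = ‖z‖²`. -/
def formA {k r : ℕ} [NeZero r] (L : ZMod r → Lagr k) (z : VR k r) : ℝ :=
  finRed HD flowHD L (fun j => z j)

/-- The form `B_r^D`, with Hamiltonian `0`, whose flow is constant. -/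
def formB {k r : ℕ} [NeZero r] (L : ZMod r → Lagr k) (z : VR k r) : ℝ :=
  finRed (fun _ => 0) (fun _ z => z) L (fun j => z j)

/-! ### Negative eigenbundles -/

/-- The negative eigenspace of a quadratic form `Q` on a Euclidean space: the span of the
eigenvectors with negative eigenvalue of its Hessian `(v, w) ↦ Q (v + w) - Q v - Q w`. -/
def negEigenspace {F : Type*} [NormedAddCommGroup F] [InnerProductSpace ℝ F] (Q : F → ℝ) :
    Submodule ℝ F :=
  Submodule.span ℝ {v | ∃ μ : ℝ, μ < 0 ∧ ∀ w, QuadraticMap.polar Q v w = μ * inner ℝ v w}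

section Bundles

variable {X F G : Type*} [TopologicalSpace X]
  [NormedAddCommGroup F] [NormedSpace ℝ F] [NormedAddCommGroup G] [NormedSpace ℝ G]

/-- The family of subspaces `ζ x` is a (locally trivial) subbundle of `X × F`: it has a continuous
frame near every point. -/
def IsSubbundle (ζ : X → Submodule ℝ F) : Prop :=
  ∀ x, ∃ U ∈ 𝓝 x, ∃ (n : ℕ) (e : Fin n → X → F), (∀ i, ContinuousOn (e i) U) ∧
    ∀ y ∈ U, LinearIndependent ℝ (fun i => e i y) ∧
      Submodule.span ℝ (range fun i => e i y) = ζ y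

/-- The total space of a family of subspaces, with the topology of a subspace of `X × F`. -/
abbrev Total (ζ : X → Submodule ℝ F) : Type _ := {p : X × F // p.2 ∈ ζ p.1}

/-- Isomorphism of vector bundles over `X`: fibrewise linear isomorphisms that are, together with
their inverses, continuous on the total spaces. -/
def BundleIso (ζ : X → Submodule ℝ F) (η : X → Submodule ℝ G) : Prop :=
  ∃ Φ : ∀ x, ζ x ≃ₗ[ℝ] η x,
    Continuous (fun p : Total ζ => (Φ p.1.1 ⟨p.1.2, p.2⟩ : G)) ∧
    Continuous (fun q : Total η => ((Φ q.1.1).symm ⟨q.1.2, q.2⟩ : F))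

end Bundles

/-! ### Loops in a Riemannian manifold and loops of Lagrangian subspaces -/

/-- `P` holds on each interval of a finite subdivision of `[0, 1]`. -/
def Piecewise (P : Set ℝ → Prop) : Prop :=
  ∃ (m : ℕ) (t : ℕ → ℝ), t 0 = 0 ∧ t m = 1 ∧
    ∀ i < m, t i < t (i + 1) ∧ P (Icc (t i) (t (i + 1)))

/-- Piecewise smooth loops in `𝓛(k)`. -/
def LagrPiecewiseSmooth {k : ℕ} (l : C(UnitAddCircle, Lagr k)) : Prop :=
  Piecewise fun s => ContDiffOn ℝ ∞ (fun t : ℝ => (l (t : UnitAddCircle)).proj) s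

/-- The energy `∫ ‖l'(t)‖² dt` of a loop in `𝓛(k)`, for the metric induced from the Grassmannian
(half of the squared Hilbert-Schmidt norm of the derivative of the orthogonal projection). -/
def lagrEnergy {k : ℕ} (l : C(UnitAddCircle, Lagr k)) : ℝ≥0∞ :=
  ∫⁻ t in Icc (0 : ℝ) 1, ENNReal.ofReal ((1 / 2) * ∑ i,
    ‖deriv (fun u : ℝ => (l (u : UnitAddCircle)).proj) t (EuclideanSpace.single i 1)‖ ^ 2)

section Riemannian

variable {d : ℕ} {N : Type*} [EMetricSpace N] [ChartedSpace (EuclideanSpace ℝ (Fin d)) N]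
  [RiemannianBundle (fun x : N => TangentSpace 𝓘(ℝ, EuclideanSpace ℝ (Fin d)) x)]

/-- The speed `‖c'(t)‖` of a curve. -/
def speed (d : ℕ) {N : Type*} [EMetricSpace N] [ChartedSpace (EuclideanSpace ℝ (Fin d)) N]
    [RiemannianBundle (fun x : N => TangentSpace 𝓘(ℝ, EuclideanSpace ℝ (Fin d)) x)]
    (c : ℝ → N) (t : ℝ) : ℝ≥0∞ :=
  ‖mfderiv 𝓘(ℝ, ℝ) 𝓘(ℝ, EuclideanSpace ℝ (Fin d)) c t (1 : ℝ)‖ₑ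

/-- The energy `∫ ‖γ'(t)‖² dt` of a loop. -/
def loopEnergy (d : ℕ) {N : Type*} [EMetricSpace N] [ChartedSpace (EuclideanSpace ℝ (Fin d)) N]
    [RiemannianBundle (fun x : N => TangentSpace 𝓘(ℝ, EuclideanSpace ℝ (Fin d)) x)]
    (γ : C(UnitAddCircle, N)) : ℝ≥0∞ :=
  ∫⁻ t in Icc (0 : ℝ) 1, speed d (fun u : ℝ => γ (u : UnitAddCircle)) t ^ 2

/-- The space `ΛW` of continuous, piecewise smooth loops of the manifold `N` that run in `W`. -/
def LoopsIn (d : ℕ) {N : Type*} [EMetricSpace N] [ChartedSpace (EuclideanSpace ℝ (Fin d)) N]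
    (W : Set N) : Type _ :=
  {γ : C(UnitAddCircle, N) //
    (Piecewise fun s => ContMDiffOn 𝓘(ℝ, ℝ) 𝓘(ℝ, EuclideanSpace ℝ (Fin d)) ∞
      (fun t : ℝ => γ (t : UnitAddCircle)) s) ∧ ∀ t, γ t ∈ W}

/-- The topology of `ΛW`: uniform convergence together with convergence of the energy. -/
instance (W : Set N) : TopologicalSpace (LoopsIn d W) :=
  TopologicalSpace.induced (fun γ => (γ.1, loopEnergy d γ.1)) inferInstance

/-- `c : [0, 1] → N` is a minimal geodesic from `x` to `y`: a smooth curve of constant speed equal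
to the distance of its endpoints. -/
def IsMinimalGeodesic (d : ℕ) {N : Type*} [EMetricSpace N]
    [ChartedSpace (EuclideanSpace ℝ (Fin d)) N]
    [RiemannianBundle (fun x : N => TangentSpace 𝓘(ℝ, EuclideanSpace ℝ (Fin d)) x)]
    (c : ℝ → N) (x y : N) : Prop :=
  ContMDiffOn 𝓘(ℝ, ℝ) 𝓘(ℝ, EuclideanSpace ℝ (Fin d)) ∞ c (Icc 0 1) ∧ c 0 = x ∧ c 1 = y ∧
    ∀ t ∈ Ioo (0 : ℝ) 1, speed d c t = edist x y

/-- Any two points of `M` at distance less than `ρ` are joined by a minimal geodesic, which runs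
in `W` and is the only curve of `N` that realizes the distance proportionally to its parameter. -/
def ShortGeodesics (d : ℕ) {N : Type*} [EMetricSpace N]
    [ChartedSpace (EuclideanSpace ℝ (Fin d)) N]
    [RiemannianBundle (fun x : N => TangentSpace 𝓘(ℝ, EuclideanSpace ℝ (Fin d)) x)]
    (M W : Set N) (ρ : ℝ≥0∞) : Prop :=
  ∀ x ∈ M, ∀ y ∈ M, edist x y < ρ →
    ∃ c : ℝ → N, IsMinimalGeodesic d c x y ∧ MapsTo c (Icc 0 1) W ∧
      ∀ σ : ℝ → N, σ 0 = x → σ 1 = y →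
        (∀ s ∈ Icc (0 : ℝ) 1, ∀ t ∈ Icc (0 : ℝ) 1,
          edist (σ s) (σ t) = ENNReal.ofReal |s - t| * edist x y) →
        EqOn σ c (Icc 0 1)

/-- The finite-dimensional loop space `Λ_{r,β} M`: closed polygons `(z_j)` in `M` whose energy
`r ∑ dist(z_j, z_{j+1})²` is less than `β`. It is topologized as a subspace of `N^r`. -/
def LoopApprox {N : Type*} [EMetricSpace N] (r : ℕ) [NeZero r] (β : ℝ≥0) (M : Set N) :
    Set (ZMod r → N) :=
  {z | (∀ j, z j ∈ M) ∧ (r : ℝ≥0∞) * ∑ j : ZMod r, edist (z j) (z (j + 1)) ^ 2 < β}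

/-- The loop `γ` is the piecewise geodesic connecting the points `z_j` in cyclic order, each piece
parametrized by an interval of length `1 / r`, with `γ(j / r) = z_j`. -/
def IsPiecewiseGeodesic (d : ℕ) {N : Type*} [EMetricSpace N]
    [ChartedSpace (EuclideanSpace ℝ (Fin d)) N]
    [RiemannianBundle (fun x : N => TangentSpace 𝓘(ℝ, EuclideanSpace ℝ (Fin d)) x)]
    {r : ℕ} (γ : C(UnitAddCircle, N)) (z : ZMod r → N) : Prop :=
  ∀ j : ℕ, IsMinimalGeodesic d (fun u : ℝ => γ ((((j : ℝ) + u) / (r : ℝ) : ℝ) : UnitAddCircle))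
    (z (j : ZMod r)) (z ((j + 1 : ℕ) : ZMod r))

end Riemannian

/-- The Lagrangian subspaces `l(j / r)`, `j ∈ ℤ/r`, on a loop `l` in `𝓛(k)`. -/
def sampled {k : ℕ} (r : ℕ) (l : C(UnitAddCircle, Lagr k)) (j : ZMod r) : Lagr k :=
  l (((j.val : ℝ) / (r : ℝ) : ℝ) : UnitAddCircle)

end FiniteReduction

end

/-!
The finite reductions `A` and `B` on `(ℝ^{2k})^r` are two members, for the angles `θ = 2 / r` and
`θ = 0`, of one family of quadratic forms. Let `S` be the operator that shifts the indices and
rotates each component by `e^{-iθ}`, let `P` be the orthogonal projection onto the product of the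
Lagrangian subspaces `L j`, and let `I` be the complex structure. The boundary terms of the action
cancel in the cyclic sum (`finRed_eq`), and twice the form is `⟪I z, S z⟫ + ⟪I P u, u⟫` with
`u = S z - z`. Its Hessian is `T = -I (S* (1 - P) + P) (S - 1)` (`hessOp`).

If consecutive Lagrangian subspaces are close and `θ` is small, then `S` almost preserves the image
of `P`, so that the terms `S* (1 - P) u` and `P u` of the gradient are almost orthogonal, and
`‖T z‖ ≥ ‖S z - z‖ / 2` (`le_norm_hessOp_apply`). Hence the kernel of `T` consists of the fixed
vectors of `S`: it is zero for `0 < θ ≤ 2 / r`, because the total rotation `rθ ≤ 2` is less than a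
full turn, and it consists of the constant polygons for `θ = 0`. Moreover, since `S - 1` does not
involve the Lagrangian subspaces, the nonzero spectrum of `T` has a distance from zero that is
uniform in them (`exists_hasGap_hessOp`). A uniform gap makes the projections onto the negative
eigenspaces continuous (`continuous_starProjection_negSpace`), so that these form vector bundles. It
also shows that the isomorphism class of the bundle does not depend on `θ` in the connected set
`0 < θ ≤ 2 / r` (`bundleIso_of_rotOp`). For `θ` close to zero, the form is negative definite on the
sum of the negative eigenspace for `θ = 0` and the constant polygons, and nonnegative on the
orthogonal complement. The sum is therefore isomorphic to the negative eigenbundle for `θ`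
(`bundleIso_sup_ker_of_small`). All isomorphisms are orthogonal projections of a subspace on which
a form is negative definite to the negative eigenspace of this form (`bundleIso_negSpace`).

The hypotheses of this argument are provided as follows. By the inequality of Cauchy and Schwarz,
the bound on the energy of the loops of Lagrangian subspaces makes consecutive subspaces close, with
a bound that depends on `C` and `r` only (`norm_sampled_sub_le`). For large `r`, consecutive
vertices of a polygon in `Λ_{r,β} M` are so close that the geodesics between them are unique and do
not leave a compact neighbourhood of `M`. By compactness and uniqueness these geodesics
depend continuously on their endpoints (`continuousOn_geodesic`), and the energy of the piecewise
geodesic loop is that of the polygon. So the loops depend continuously on the polygon in the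
topology of uniform convergence and convergence of energy (`exists_piecewiseGeodesic`).
-/

namespace FiniteReduction

/-! ### Families of subspaces with continuous orthogonal projections -/

section Bundles

variable {X F G H : Type*} [TopologicalSpace X]
  [NormedAddCommGroup F] [NormedSpace ℝ F] [NormedAddCommGroup G] [NormedSpace ℝ G]
  [NormedAddCommGroup H] [NormedSpace ℝ H]

theorem BundleIso.symm {ζ : X → Submodule ℝ F} {η : X → Submodule ℝ G} (h : BundleIso ζ η) :
    BundleIso η ζ := by
  obtain ⟨Φ, h₁, h₂⟩ := h
  exact ⟨fun x => (Φ x).symm, h₂, h₁⟩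

theorem BundleIso.trans {ζ : X → Submodule ℝ F} {η : X → Submodule ℝ G} {ξ : X → Submodule ℝ H}
    (h : BundleIso ζ η) (h' : BundleIso η ξ) : BundleIso ζ ξ := by
  obtain ⟨Φ, h₁, h₂⟩ := h
  obtain ⟨Ψ, h₃, h₄⟩ := h'
  have c₁ : Continuous (fun p : Total ζ =>
      (⟨(p.1.1, (Φ p.1.1 ⟨p.1.2, p.2⟩ : G)), (Φ p.1.1 ⟨p.1.2, p.2⟩).2⟩ : Total η)) :=
    ((continuous_fst.comp continuous_subtype_val).prodMk h₁).subtype_mk _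
  have c₂ : Continuous (fun p : Total ξ =>
      (⟨(p.1.1, ((Ψ p.1.1).symm ⟨p.1.2, p.2⟩ : G)), ((Ψ p.1.1).symm ⟨p.1.2, p.2⟩).2⟩ : Total η)) :=
    ((continuous_fst.comp continuous_subtype_val).prodMk h₄).subtype_mk _
  exact ⟨fun x => (Φ x).trans (Ψ x), h₃.comp c₁, h₂.comp c₂⟩

/-- Mutually inverse continuous families of linear maps of the ambient spaces induce an isomorphism
of families of subspaces. -/
theorem bundleIso_of_inverse {ζ : X → Submodule ℝ F} {η : X → Submodule ℝ G}
    (A : X → F →L[ℝ] G) (B : X → G →L[ℝ] F) (hA : Continuous A) (hB : Continuous B)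
    (hAm : ∀ x, ∀ v ∈ ζ x, A x v ∈ η x) (hBm : ∀ x, ∀ w ∈ η x, B x w ∈ ζ x)
    (hBA : ∀ x, ∀ v ∈ ζ x, B x (A x v) = v) (hAB : ∀ x, ∀ w ∈ η x, A x (B x w) = w) :
    BundleIso ζ η := by
  refine ⟨fun x => LinearEquiv.ofLinearMap
    ((A x : F →ₗ[ℝ] G).restrict (hAm x)) ((B x : G →ₗ[ℝ] F).restrict (hBm x)) ?_ ?_, ?_, ?_⟩
  · ext w
    exact hAB x w.1 w.2
  · ext v
    exact hBA x v.1 v.2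
  · exact (hA.comp (continuous_fst.comp continuous_subtype_val)).clm_apply
      (continuous_snd.comp continuous_subtype_val)
  · exact (hB.comp (continuous_fst.comp continuous_subtype_val)).clm_apply
      (continuous_snd.comp continuous_subtype_val)

end Bundles

section Euclidean

variable {X F : Type*} [TopologicalSpace X]
  [NormedAddCommGroup F] [InnerProductSpace ℝ F] [FiniteDimensional ℝ F]

/-- Subspaces whose orthogonal projections have distance less than one satisfy an inequality of
dimensions: the one projection is injective on the range of the other. -/
theorem finrank_le_of_norm_starProjection_sub_lt_one {U W : Submodule ℝ F}
    (h : ‖U.starProjection - W.starProjection‖ < 1) :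
    Module.finrank ℝ U ≤ Module.finrank ℝ W := by
  have hinj : Function.Injective
      ((W.orthogonalProjectionOnto : F →ₗ[ℝ] W).domRestrict U) := by
    rw [← LinearMap.ker_eq_bot, LinearMap.ker_eq_bot']
    intro v hv
    have hW : W.starProjection (v : F) = 0 := by
      have : W.orthogonalProjectionOnto (v : F) = 0 := hv
      rw [Submodule.starProjection_apply, this]; rfl
    have hU : U.starProjection (v : F) = v := Submodule.starProjection_eq_self_iff.2 v.2
    have h1 : ‖(v : F)‖ ≤ ‖U.starProjection - W.starProjection‖ * ‖(v : F)‖ := by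
      have := (U.starProjection - W.starProjection).le_opNorm (v : F)
      simpa [hW, hU] using this
    by_contra hne
    have hpos : 0 < ‖(v : F)‖ := norm_pos_iff.2 fun h0 => hne (Subtype.ext h0)
    nlinarith
  exact LinearMap.finrank_le_finrank_of_injective hinj

/-- A family of subspaces with continuous orthogonal projections is a subbundle: near `x`, the
projection of a basis of `ζ x` is a frame. -/
theorem isSubbundle_of_continuous {ζ : X → Submodule ℝ F}
    (hζ : Continuous fun x => (ζ x).starProjection) : IsSubbundle ζ := by
  intro x
  let b := Module.finBasis ℝ (ζ x)
  let e : Fin (Module.finrank ℝ (ζ x)) → X → F := fun i y => (ζ y).starProjection (b i : F)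
  have he : ∀ i, Continuous (e i) := fun i => hζ.clm_apply continuous_const
  have hx : LinearIndependent ℝ (fun i => e i x) := by
    have : (fun i => e i x) = fun i => ((b i : ζ x) : F) := by
      funext i
      exact Submodule.starProjection_eq_self_iff.2 (b i).2
    rw [this]
    exact b.linearIndependent.map' (ζ x).subtype (Submodule.ker_subtype _)
  have hopen : ∀ᶠ y in 𝓝 x, LinearIndependent ℝ (fun i => e i y) := by
    have hc : Continuous (fun y => fun i => e i y) := continuous_pi he
    exact hc.continuousAt.eventually_mem (isOpen_setOfPred_linearIndependent.mem_nhds hx)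
  have hdim : ∀ᶠ y in 𝓝 x, ‖(ζ y).starProjection - (ζ x).starProjection‖ < 1 := by
    have hc : Continuous (fun y => ‖(ζ y).starProjection - (ζ x).starProjection‖) :=
      (hζ.sub continuous_const).norm
    exact hc.continuousAt.eventually_lt continuousAt_const (by simp)
  refine ⟨_, hopen.and hdim, _, e, fun i => (he i).continuousOn, fun y hy => ⟨hy.1, ?_⟩⟩
  refine Submodule.eq_of_le_of_finrank_le ?_ ?_
  · rw [Submodule.span_le]
    rintro _ ⟨i, rfl⟩
    exact Submodule.starProjection_apply_mem _ _
  · rw [finrank_span_eq_card hy.1, Fintype.card_fin]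
    exact finrank_le_of_norm_starProjection_sub_lt_one hy.2

open ContinuousLinearMap in
/-- A continuous family of linear maps that restricts to injections `ζ x → η x` between subspaces
of equal dimension is an isomorphism. With `p` the projection onto `ζ x`, the restricted inverse is
`((A p)* (A p) + (1 - p)* (1 - p))⁻¹ (A p)*`, which depends continuously on `x`. -/
theorem bundleIso_of_injective {ζ η : X → Submodule ℝ F} (A : X → F →L[ℝ] F)
    (hζ : Continuous fun x => (ζ x).starProjection) (hA : Continuous A)
    (hAm : ∀ x, ∀ v ∈ ζ x, A x v ∈ η x) (hinj : ∀ x, ∀ v ∈ ζ x, A x v = 0 → v = 0)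
    (hdim : ∀ x, Module.finrank ℝ (η x) ≤ Module.finrank ℝ (ζ x)) : BundleIso ζ η := by
  let p : X → F →L[ℝ] F := fun x => (ζ x).starProjection
  let Q : X → F →L[ℝ] F := fun x => A x ∘L p x
  let M : X → F →L[ℝ] F := fun x =>
    adjoint (Q x) ∘L Q x + adjoint (.id ℝ F - p x) ∘L (.id ℝ F - p x)
  have hp : Continuous p := hζ
  have hQ : Continuous Q := hA.clm_comp hp
  have hadj : ∀ {f : X → F →L[ℝ] F}, Continuous f → Continuous fun x => adjoint (f x) := fun hf =>
    (LinearIsometryEquiv.continuous _).comp hf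
  have hM : Continuous M :=
    ((hadj hQ).clm_comp hQ).add
      ((hadj (continuous_const.sub hp)).clm_comp (continuous_const.sub hp))
  have hMunit : ∀ x, IsUnit (M x) := by
    intro x
    have hker : ∀ v, M x v = 0 → v = 0 := by
      intro v hv
      have h0 : inner ℝ (M x v) v = ‖Q x v‖ ^ 2 + ‖v - p x v‖ ^ 2 := by
        simp only [M, add_apply, comp_apply, inner_add_left, adjoint_inner_left,
          real_inner_self_eq_norm_sq]
        rfl
      rw [hv, inner_zero_left] at h0
      have h1 : ‖Q x v‖ = 0 := by
        nlinarith [sq_nonneg ‖Q x v‖, sq_nonneg ‖v - p x v‖]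
      have h2 : ‖v - p x v‖ = 0 := by
        nlinarith [sq_nonneg ‖Q x v‖, sq_nonneg ‖v - p x v‖]
      have h3 : p x v = v := by
        exact (sub_eq_zero.1 (norm_eq_zero.1 h2)).symm
      have h4 : A x (p x v) = 0 := norm_eq_zero.1 h1
      rw [h3] at h4
      exact hinj x v (h3 ▸ Submodule.starProjection_apply_mem _ _) h4
    have hbij : Function.Bijective (M x : F →ₗ[ℝ] F) := by
      have hi : Function.Injective (M x : F →ₗ[ℝ] F) := by
        rw [← LinearMap.ker_eq_bot, LinearMap.ker_eq_bot']
        exact hker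
      exact ⟨hi, LinearMap.injective_iff_surjective.1 hi⟩
    rw [ContinuousLinearMap.isUnit_iff_bijective]
    exact hbij
  have hleft : ∀ x, ∀ v ∈ ζ x, Ring.inverse (M x) (adjoint (Q x) (A x v)) = v := by
    intro x v hv
    have hpv : p x v = v := Submodule.starProjection_eq_self_iff.2 hv
    have hMv : M x v = adjoint (Q x) (A x v) := by
      simp [M, Q, hpv]
    rw [← hMv]
    exact DFunLike.congr_fun (Ring.inverse_mul_cancel _ (hMunit x)) v
  have hsurj : ∀ x, ∀ w ∈ η x, ∃ v ∈ ζ x, A x v = w := by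
    intro x w hw
    let f : ζ x →ₗ[ℝ] η x := (A x : F →ₗ[ℝ] F).restrict (hAm x)
    have hf : Function.Injective f := by
      rw [← LinearMap.ker_eq_bot, LinearMap.ker_eq_bot']
      intro v hv
      exact Subtype.ext (hinj x v v.2 (congrArg Subtype.val hv))
    have hd : Module.finrank ℝ (ζ x) = Module.finrank ℝ (η x) :=
      le_antisymm (LinearMap.finrank_le_finrank_of_injective hf) (hdim x)
    obtain ⟨v, hv⟩ := (LinearMap.injective_iff_surjective_of_finrank_eq_finrank hd).1 hf ⟨w, hw⟩
    exact ⟨v, v.2, congrArg Subtype.val hv⟩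
  refine bundleIso_of_inverse A (fun x => Ring.inverse (M x) ∘L adjoint (Q x)) hA ?_ hAm ?_ hleft ?_
  · refine Continuous.clm_comp ?_ (hadj hQ)
    rw [continuous_iff_continuousAt]
    intro x
    obtain ⟨u, hu⟩ := hMunit x
    exact ContinuousAt.comp (f := M) (x := x)
      (hu ▸ NormedRing.inverse_continuousAt u) hM.continuousAt
  · intro x w hw
    obtain ⟨v, hv, rfl⟩ := hsurj x w hw
    rw [comp_apply, hleft x v hv]
    exact hv
  · intro x w hw
    obtain ⟨v, hv, rfl⟩ := hsurj x w hw
    rw [comp_apply, hleft x v hv]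

end Euclidean

/-! ### Negative eigenspaces of symmetric operators -/

section Spectral

variable {F : Type*} [NormedAddCommGroup F] [InnerProductSpace ℝ F]

/-- The span of the eigenvectors with negative eigenvalue of an operator. -/
def negSpace (T : F →L[ℝ] F) : Submodule ℝ F :=
  Submodule.span ℝ {v | ∃ μ : ℝ, μ < 0 ∧ T v = μ • v}

theorem negEigenspace_eq_negSpace {Q : F → ℝ} {T : F →L[ℝ] F}
    (h : ∀ v w, QuadraticMap.polar Q v w = inner ℝ (T v) w) : negEigenspace Q = negSpace T := by
  unfold negEigenspace negSpace
  congr 1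
  ext v
  simp only [mem_ofPred_eq]
  refine exists_congr fun μ => and_congr_right fun _ => ?_
  simp only [h, ← real_inner_smul_left]
  exact ⟨fun h' => ext_inner_right ℝ h', fun h' w => by rw [h']⟩

theorem isOrtho_negSpace_ker {T : F →L[ℝ] F} (hT : (T : F →ₗ[ℝ] F).IsSymmetric) :
    negSpace T ⟂ LinearMap.ker (T : F →ₗ[ℝ] F) := by
  rw [negSpace, Submodule.isOrtho_iff_le, Submodule.span_le]
  rintro v ⟨μ, hμ, hv⟩
  rw [SetLike.mem_coe, Submodule.mem_orthogonal]
  intro u hu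
  have h1 : inner ℝ (T u) v = inner ℝ u (T v) := hT u v
  rw [show T u = 0 from hu, inner_zero_left, hv, real_inner_smul_right] at h1
  exact (mul_eq_zero.1 h1.symm).resolve_left hμ.ne

/-- `T` has no spectrum at distance less than `g` from zero, except possibly zero itself. -/
def HasGap (g : ℝ) (T : F →L[ℝ] F) : Prop :=
  (T : F →ₗ[ℝ] F).IsSymmetric ∧ ∀ v ∈ (LinearMap.ker (T : F →ₗ[ℝ] F))ᗮ, g * ‖v‖ ≤ ‖T v‖

/-- Eigenvectors of a nonzero eigenvalue are orthogonal to the kernel, so that the gap bounds the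
eigenvalue. -/
theorem HasGap.le_abs {g : ℝ} {T : F →L[ℝ] F} (hT : HasGap g T) {μ : ℝ} {v : F} (hμ : μ ≠ 0)
    (hv : v ≠ 0) (h : T v = μ • v) : g ≤ |μ| := by
  have hmem : v ∈ (LinearMap.ker (T : F →ₗ[ℝ] F))ᗮ := by
    rw [Submodule.mem_orthogonal]
    intro u hu
    have h1 : inner ℝ (T u) v = inner ℝ u (T v) := hT.1 u v
    rw [show T u = 0 from hu, inner_zero_left, h, real_inner_smul_right] at h1
    exact (mul_eq_zero.1 h1.symm).resolve_left hμ
  have h2 := hT.2 v hmem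
  rw [h, norm_smul, Real.norm_eq_abs] at h2
  exact le_of_mul_le_mul_right h2 (norm_pos_iff.2 hv)

theorem abs_inner_sub_le (T T' : F →L[ℝ] F) (v : F) :
    |inner ℝ (T' v) v - inner ℝ (T v) v| ≤ ‖T' - T‖ * ‖v‖ ^ 2 := by
  rw [← inner_sub_left, ← sub_apply]
  calc _ ≤ ‖(T' - T) v‖ * ‖v‖ := abs_real_inner_le_norm _ _
    _ ≤ ‖T' - T‖ * ‖v‖ * ‖v‖ :=
      mul_le_mul_of_nonneg_right ((T' - T).le_opNorm v) (norm_nonneg _)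
    _ = _ := by ring

variable [FiniteDimensional ℝ F]

/-- The operator `T` maps its negative eigenspace to itself and therefore commutes with the
projection onto it. -/
theorem starProjection_negSpace_comm {T : F →L[ℝ] F} (hT : (T : F →ₗ[ℝ] F).IsSymmetric) (v : F) :
    (negSpace T).starProjection (T v) = T ((negSpace T).starProjection v) := by
  have hinv : ∀ w ∈ negSpace T, T w ∈ negSpace T := by
    intro w hw
    induction hw using Submodule.span_induction with
    | mem x hx =>
      obtain ⟨μ, hμ, h⟩ := hx
      rw [h]
      exact Submodule.smul_mem _ _ (Submodule.subset_span ⟨μ, hμ, h⟩)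
    | zero => simp
    | add x y _ _ hx hy => rw [map_add]; exact Submodule.add_mem _ hx hy
    | smul a x _ hx => rw [map_smul]; exact Submodule.smul_mem _ _ hx
  apply Submodule.eq_starProjection_of_mem_of_inner_eq_zero
  · exact hinv _ (Submodule.starProjection_apply_mem _ _)
  · intro w hw
    rw [← map_sub]
    have h1 : inner ℝ (T (v - (negSpace T).starProjection v)) w =
        inner ℝ (v - (negSpace T).starProjection v) (T w) := hT _ _
    rw [h1]
    exact Submodule.starProjection_inner_eq_zero v _ (hinv w hw)

/-- The quadratic form of `T` in the coordinates of an orthonormal basis of eigenvectors. -/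
theorem inner_self_eq_sum {T : F →L[ℝ] F} (hT : (T : F →ₗ[ℝ] F).IsSymmetric) (v : F) :
    inner ℝ (T v) v = ∑ i, hT.eigenvalues rfl i * inner ℝ (hT.eigenvectorBasis rfl i) v ^ 2 := by
  rw [← (hT.eigenvectorBasis rfl).sum_inner_mul_inner]
  refine Finset.sum_congr rfl fun i _ => ?_
  have h1 : inner ℝ (T v) (hT.eigenvectorBasis rfl i) =
      inner ℝ v (T (hT.eigenvectorBasis rfl i)) := hT _ _
  have h2 : T (hT.eigenvectorBasis rfl i) = hT.eigenvalues rfl i • hT.eigenvectorBasis rfl i :=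
    hT.apply_eigenvectorBasis rfl i
  rw [h1, h2, real_inner_smul_right, real_inner_comm]
  ring

theorem norm_sq_eq_sum {T : F →L[ℝ] F} (hT : (T : F →ₗ[ℝ] F).IsSymmetric) (v : F) :
    ‖v‖ ^ 2 = ∑ i, inner ℝ (hT.eigenvectorBasis rfl i) v ^ 2 := by
  rw [← real_inner_self_eq_norm_sq, ← (hT.eigenvectorBasis rfl).sum_inner_mul_inner]
  refine Finset.sum_congr rfl fun i _ => ?_
  rw [real_inner_comm]
  ring

theorem inner_eigenvectorBasis_eq_zero_of_nonneg {T : F →L[ℝ] F}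
    (hT : (T : F →ₗ[ℝ] F).IsSymmetric) {v : F} (hv : v ∈ negSpace T)
    {i : Fin (Module.finrank ℝ F)} (hi : 0 ≤ hT.eigenvalues rfl i) :
    inner ℝ (hT.eigenvectorBasis rfl i) v = 0 := by
  have h2 : T (hT.eigenvectorBasis rfl i) = hT.eigenvalues rfl i • hT.eigenvectorBasis rfl i :=
    hT.apply_eigenvectorBasis rfl i
  induction hv using Submodule.span_induction with
  | mem x hx =>
    obtain ⟨μ, hμ, h⟩ := hx
    have h1 : inner ℝ (T (hT.eigenvectorBasis rfl i)) x =
      inner ℝ (hT.eigenvectorBasis rfl i) (T x) := hT _ _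
    rw [h2, h, real_inner_smul_left, real_inner_smul_right] at h1
    have h3 : (hT.eigenvalues rfl i - μ) * inner ℝ (hT.eigenvectorBasis rfl i) x = 0 := by
      linarith
    exact (mul_eq_zero.1 h3).resolve_left (by linarith)
  | zero => simp
  | add x y _ _ hx hy => rw [inner_add_right, hx, hy, add_zero]
  | smul a x _ hx => rw [real_inner_smul_right, hx, mul_zero]

theorem inner_eigenvectorBasis_eq_zero_of_neg {T : F →L[ℝ] F}
    (hT : (T : F →ₗ[ℝ] F).IsSymmetric) {v : F} (hv : v ∈ (negSpace T)ᗮ)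
    {i : Fin (Module.finrank ℝ F)} (hi : hT.eigenvalues rfl i < 0) :
    inner ℝ (hT.eigenvectorBasis rfl i) v = 0 :=
  (Submodule.mem_orthogonal _ _).1 hv _
    (Submodule.subset_span ⟨_, hi, hT.apply_eigenvectorBasis rfl i⟩)

theorem HasGap.inner_le {g : ℝ} {T : F →L[ℝ] F} (hT : HasGap g T) {v : F} (hv : v ∈ negSpace T) :
    inner ℝ (T v) v ≤ -g * ‖v‖ ^ 2 := by
  rw [inner_self_eq_sum hT.1, norm_sq_eq_sum hT.1, Finset.mul_sum]
  refine Finset.sum_le_sum fun i _ => ?_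
  rcases le_or_gt 0 (hT.1.eigenvalues rfl i) with hi | hi
  · simp [inner_eigenvectorBasis_eq_zero_of_nonneg hT.1 hv hi]
  · have h1 := hT.le_abs hi.ne ((hT.1.eigenvectorBasis rfl).toBasis.ne_zero i)
      (by rw [OrthonormalBasis.coe_toBasis]; exact hT.1.apply_eigenvectorBasis rfl i)
    rw [abs_of_neg hi] at h1
    exact mul_le_mul_of_nonneg_right (by linarith) (sq_nonneg _)

theorem inner_nonneg_of_mem_orthogonal {T : F →L[ℝ] F} (hT : (T : F →ₗ[ℝ] F).IsSymmetric) {v : F}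
    (hv : v ∈ (negSpace T)ᗮ) : 0 ≤ inner ℝ (T v) v := by
  rw [inner_self_eq_sum hT]
  refine Finset.sum_nonneg fun i _ => ?_
  rcases le_or_gt 0 (hT.eigenvalues rfl i) with hi | hi
  · positivity
  · simp [inner_eigenvectorBasis_eq_zero_of_neg hT hv hi]

theorem HasGap.le_inner {g : ℝ} {T : F →L[ℝ] F} (hT : HasGap g T) {v : F}
    (hv : v ∈ (negSpace T)ᗮ) (hv' : v ∈ (LinearMap.ker (T : F →ₗ[ℝ] F))ᗮ) :
    g * ‖v‖ ^ 2 ≤ inner ℝ (T v) v := by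
  rw [inner_self_eq_sum hT.1, norm_sq_eq_sum hT.1, Finset.mul_sum]
  refine Finset.sum_le_sum fun i _ => ?_
  have h2 : T (hT.1.eigenvectorBasis rfl i) =
    hT.1.eigenvalues rfl i • hT.1.eigenvectorBasis rfl i := hT.1.apply_eigenvectorBasis rfl i
  rcases lt_trichotomy 0 (hT.1.eigenvalues rfl i) with hi | hi | hi
  · have h1 := hT.le_abs hi.ne' ((hT.1.eigenvectorBasis rfl).toBasis.ne_zero i)
      (by rw [OrthonormalBasis.coe_toBasis]; exact h2)
    rw [abs_of_pos hi] at h1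
    exact mul_le_mul_of_nonneg_right h1 (sq_nonneg _)
  · rw [← hi, zero_smul] at h2
    have : inner ℝ (hT.1.eigenvectorBasis rfl i) v = 0 :=
      (Submodule.mem_orthogonal _ _).1 hv' _ h2
    simp [this]
  · simp [inner_eigenvectorBasis_eq_zero_of_neg hT.1 hv hi]

/-- If each of two subspaces is almost contained in the other, then their projections are close. -/
theorem norm_starProjection_sub_le {U W : Submodule ℝ F} {δ : ℝ} (hδ : 0 ≤ δ)
    (hU : ∀ v ∈ U, ‖v - W.starProjection v‖ ≤ δ * ‖v‖)
    (hW : ∀ v ∈ W, ‖v - U.starProjection v‖ ≤ δ * ‖v‖) :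
    ‖W.starProjection - U.starProjection‖ ≤ 2 * δ := by
  refine ContinuousLinearMap.opNorm_le_bound _ (by positivity) fun v => ?_
  have h1 : ‖U.starProjection v - W.starProjection (U.starProjection v)‖ ≤ δ * ‖v‖ :=
    (hU _ (Submodule.starProjection_apply_mem _ _)).trans
      (mul_le_mul_of_nonneg_left (Submodule.norm_starProjection_apply_le U v) hδ)
  -- the other half of the difference is bounded by duality
  have h2 : ‖W.starProjection (v - U.starProjection v)‖ ≤ δ * ‖v‖ := by
    set w := W.starProjection (v - U.starProjection v) with hw
    have hwW : w ∈ W := Submodule.starProjection_apply_mem _ _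
    have e1 : inner ℝ w w = inner ℝ (w - U.starProjection w) v := by
      have a1 : inner ℝ w w = inner ℝ w (v - U.starProjection v) := by
        conv_lhs => rw [hw, Submodule.inner_starProjection_left_eq_right, ← hw]
        rw [real_inner_comm, Submodule.starProjection_eq_self_iff.2 hwW]
      rw [a1, inner_sub_right, inner_sub_left, ← Submodule.inner_starProjection_left_eq_right]
    have e2 : ‖w‖ * ‖w‖ ≤ δ * ‖v‖ * ‖w‖ := by
      rw [← real_inner_self_eq_norm_mul_norm, e1]
      calc _ ≤ ‖w - U.starProjection w‖ * ‖v‖ := real_inner_le_norm _ _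
        _ ≤ δ * ‖w‖ * ‖v‖ := mul_le_mul_of_nonneg_right (hW w hwW) (norm_nonneg _)
        _ = _ := by ring
    rcases (norm_nonneg w).eq_or_lt with h0 | h0
    · rw [← h0]; positivity
    · exact le_of_mul_le_mul_right e2 h0
  have e : (W.starProjection - U.starProjection) v = W.starProjection (v - U.starProjection v)
      - (U.starProjection v - W.starProjection (U.starProjection v)) := by
    rw [map_sub, sub_apply]; abel
  rw [e]
  calc _ ≤ _ := norm_sub_le _ _
    _ ≤ δ * ‖v‖ + δ * ‖v‖ := add_le_add h2 h1
    _ = _ := by ring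

/-- The negative eigenspace of `T` is almost contained in that of a nearby operator. For an
eigenvector `v` of `T`, its component `w` orthogonal to the negative eigenspace of `T'` satisfies
`0 ≤ ⟪T' w, w⟫ ≤ -g ‖w‖² + ‖T' - T‖ ‖v‖ ‖w‖`. -/
theorem HasGap.norm_sub_starProjection_le {g : ℝ} (hg : 0 < g) {T T' : F →L[ℝ] F}
    (hT : HasGap g T) (hT' : (T' : F →ₗ[ℝ] F).IsSymmetric) {v : F} (hv : v ∈ negSpace T) :
    ‖v - (negSpace T').starProjection v‖ ≤ Module.finrank ℝ F * (‖T' - T‖ / g) * ‖v‖ := by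
  set q := (negSpace T').starProjection with hq
  have key : ∀ (μ : ℝ) (v : F), μ < 0 → ‖v‖ = 1 → T v = μ • v → ‖v - q v‖ ≤ ‖T' - T‖ / g := by
    intro μ v hμ hv h
    set w := v - q v with hw
    have hwo : w ∈ (negSpace T')ᗮ := Submodule.sub_starProjection_mem_orthogonal v
    have hgμ : g ≤ -μ := by
      have := hT.le_abs hμ.ne (norm_pos_iff.1 (by rw [hv]; norm_num)) h
      rwa [abs_of_neg hμ] at this
    have h0 : 0 ≤ inner ℝ (T' w) w := inner_nonneg_of_mem_orthogonal hT' hwo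
    have e1 : T' w = T' v - q (T' v) := by
      rw [hw, map_sub, hq, starProjection_negSpace_comm hT']
    have e2 : inner ℝ (q (T' v)) w = 0 :=
      (Submodule.mem_orthogonal _ _).1 hwo _ (Submodule.starProjection_apply_mem _ _)
    have e3 : inner ℝ v w = ‖w‖ ^ 2 := by
      have e4 : inner ℝ (q v) w = 0 :=
        (Submodule.mem_orthogonal _ _).1 hwo _ (Submodule.starProjection_apply_mem _ _)
      have e5 : inner ℝ v w = inner ℝ (w + q v) w := by rw [hw, sub_add_cancel]
      rw [e5, inner_add_left, e4, add_zero, real_inner_self_eq_norm_sq]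
    have e6 : inner ℝ (T' w) w = μ * ‖w‖ ^ 2 + inner ℝ ((T' - T) v) w := by
      rw [e1, inner_sub_left, e2, sub_apply, inner_sub_left, h,
        real_inner_smul_left, e3]
      ring
    have e7 : inner ℝ ((T' - T) v) w ≤ ‖T' - T‖ * ‖w‖ :=
      (real_inner_le_norm _ _).trans (mul_le_mul_of_nonneg_right
        (by simpa [hv] using (T' - T).le_opNorm v) (norm_nonneg _))
    rw [le_div_iff₀ hg]
    rcases (norm_nonneg w).eq_or_lt with hz | hz
    · rw [← hz, zero_mul]; exact norm_nonneg _
    · nlinarith [mul_le_mul_of_nonneg_right hgμ (sq_nonneg ‖w‖)]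
  let b := hT.1.eigenvectorBasis rfl
  have hsum : v - q v = ∑ i, inner ℝ (b i) v • (b i - q (b i)) := by
    conv_lhs => rw [← b.sum_repr' v]
    simp only [map_sum, map_smul, smul_sub, Finset.sum_sub_distrib]
  rw [hsum]
  calc _ ≤ ∑ i : Fin (Module.finrank ℝ F), ‖T' - T‖ / g * ‖v‖ := by
        refine (norm_sum_le _ _).trans (Finset.sum_le_sum fun i _ => ?_)
        rcases le_or_gt 0 (hT.1.eigenvalues rfl i) with hi | hi
        · rw [inner_eigenvectorBasis_eq_zero_of_nonneg hT.1 hv hi, zero_smul, norm_zero]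
          positivity
        · have h1 : ‖b i‖ = 1 := b.norm_eq_one i
          rw [norm_smul, mul_comm]
          refine mul_le_mul (key _ _ hi h1 (hT.1.apply_eigenvectorBasis rfl i)) ?_ (norm_nonneg _)
            (by positivity)
          have := norm_inner_le_norm (𝕜 := ℝ) (b i) v
          rwa [h1, one_mul] at this
    _ = _ := by simp; ring

/-- With a uniform gap, the negative eigenspace depends continuously on the operator. -/
theorem continuous_starProjection_negSpace {X : Type*} [TopologicalSpace X] {g : ℝ} (hg : 0 < g)
    {T : X → F →L[ℝ] F} (hT : Continuous T) (hgap : ∀ x, HasGap g (T x)) :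
    Continuous fun x => (negSpace (T x)).starProjection := by
  rw [continuous_iff_continuousAt]
  intro x
  rw [ContinuousAt, tendsto_iff_norm_sub_tendsto_zero]
  refine squeeze_zero (g := fun y => 2 * (Module.finrank ℝ F * (‖T y - T x‖ / g)))
    (fun _ => norm_nonneg _) (fun y => ?_) ?_
  · refine norm_starProjection_sub_le (by positivity)
      (fun v hv => (hgap x).norm_sub_starProjection_le hg (hgap y).1 hv) (fun v hv => ?_)
    rw [norm_sub_rev (T y)]
    exact (hgap y).norm_sub_starProjection_le hg (hgap x).1 hv
  · have hc : Continuous fun y => 2 * (Module.finrank ℝ F * (‖T y - T x‖ / g)) := by fun_prop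
    simpa using hc.tendsto x

variable {X : Type*} [TopologicalSpace X]

/-- A family of subspaces on which the forms of `T` are negative definite, while they are
nonnegative on the orthogonal complements, is isomorphic to the family of negative eigenspaces of
`T`: orthogonal projection is an isomorphism. -/
theorem bundleIso_negSpace {g : ℝ} (hg : 0 < g) {T : X → F →L[ℝ] F} (hT : Continuous T)
    (hgap : ∀ x, HasGap g (T x)) {W : X → Submodule ℝ F}
    (hW : Continuous fun x => (W x).starProjection)
    (hneg : ∀ x, ∀ v ∈ W x, v ≠ 0 → inner ℝ (T x v) v < 0)
    (hnonneg : ∀ x, ∀ v ∈ (W x)ᗮ, 0 ≤ inner ℝ (T x v) v) :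
    BundleIso W fun x => negSpace (T x) := by
  refine bundleIso_of_injective (fun x => (negSpace (T x)).starProjection) hW
    (continuous_starProjection_negSpace hg hT hgap)
    (fun x v _ => Submodule.starProjection_apply_mem _ _) (fun x v hv h0 => ?_) fun x => ?_
  · by_contra hne
    exact absurd (inner_nonneg_of_mem_orthogonal (hgap x).1
      ((Submodule.starProjection_apply_eq_zero_iff _).1 h0)) (not_le.2 (hneg x v hv hne))
  · have hinj : Function.Injective
        (((W x).orthogonalProjectionOnto : F →ₗ[ℝ] W x).domRestrict (negSpace (T x))) := by
      rw [← LinearMap.ker_eq_bot, LinearMap.ker_eq_bot']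
      intro v hv
      have h0 : (W x).starProjection (v : F) = 0 := by
        have : (W x).orthogonalProjectionOnto (v : F) = 0 := hv
        rw [Submodule.starProjection_apply, this]; rfl
      have h1 := hnonneg x v ((Submodule.starProjection_apply_eq_zero_iff _).1 h0)
      have h2 := (hgap x).inner_le v.2
      have h3 : ‖(v : F)‖ ^ 2 = 0 := by nlinarith [sq_nonneg ‖(v : F)‖]
      exact Subtype.ext (norm_eq_zero.1 (pow_eq_zero_iff two_ne_zero |>.1 h3))
    exact LinearMap.finrank_le_finrank_of_injective hinj

/-- Perturbations of nondegenerate forms that are smaller than the gap do not change the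
isomorphism class of the negative eigenbundle. -/
theorem bundleIso_negSpace_of_norm_sub_lt {g g' : ℝ} (hg : 0 < g) (hg' : 0 < g')
    {T T' : X → F →L[ℝ] F} (hT : Continuous T) (hT' : Continuous T') (hgap : ∀ x, HasGap g (T x))
    (hgap' : ∀ x, HasGap g' (T' x)) (hker : ∀ x, LinearMap.ker (T x : F →ₗ[ℝ] F) = ⊥)
    (h : ∀ x, ‖T' x - T x‖ < g) :
    BundleIso (fun x => negSpace (T x)) fun x => negSpace (T' x) := by
  refine bundleIso_negSpace hg' hT' hgap' (continuous_starProjection_negSpace hg hT hgap)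
    (fun x v hv hne => ?_) (fun x v hv => ?_)
  · have h1 := (hgap x).inner_le hv
    have h2 := (abs_le.1 (abs_inner_sub_le (T x) (T' x) v)).2
    have h3 : 0 < ‖v‖ ^ 2 := by positivity
    nlinarith [h x]
  · have h1 := (hgap x).le_inner hv (by rw [hker x]; simp)
    have h2 := (abs_le.1 (abs_inner_sub_le (T x) (T' x) v)).1
    nlinarith [h x, sq_nonneg ‖v‖]

end Spectral

/-! ### The Hessian as an operator -/

section Operators

variable {E : Type*} [NormedAddCommGroup E] [InnerProductSpace ℝ E]

/-- Orthogonal complex structures. -/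
structure IsCplx (I : E →L[ℝ] E) : Prop where
  skew : ∀ a b, inner ℝ (I a) b = -inner ℝ a (I b)
  sq : ∀ a, I (I a) = -a

/-- Isometric operators that commute with `I`. -/
structure IsUnitaryFor (I S : E →L[ℝ] E) : Prop where
  inner_map : ∀ a b, inner ℝ (S a) (S b) = inner ℝ a b
  comm : ∀ a, S (I a) = I (S a)

/-- Orthogonal projections that `I` conjugates to the complementary projection: those onto
Lagrangian subspaces. -/
structure IsLagrProj (I P : E →L[ℝ] E) : Prop where
  symm : ∀ a b, inner ℝ (P a) b = inner ℝ a (P b)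
  idem : ∀ a, P (P a) = P a
  comm : ∀ a, I (P a) = I a - P (I a)

theorem norm_map_of_inner_map {S : E →L[ℝ] E} (h : ∀ a b, inner ℝ (S a) (S b) = inner ℝ a b)
    (a : E) : ‖S a‖ = ‖a‖ := by
  have := h a a
  rw [real_inner_self_eq_norm_sq, real_inner_self_eq_norm_sq] at this
  exact (sq_eq_sq₀ (norm_nonneg _) (norm_nonneg _)).1 this

theorem opNorm_le_one_of_norm_map_le {S : E →L[ℝ] E} (h : ∀ a, ‖S a‖ ≤ ‖a‖) : ‖S‖ ≤ 1 :=
  S.opNorm_le_bound zero_le_one fun a => by simpa using h a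

section Cplx

variable {I : E →L[ℝ] E}

theorem IsCplx.inner_map (hI : IsCplx I) (a b : E) : inner ℝ (I a) (I b) = inner ℝ a b := by
  rw [hI.skew, hI.sq, inner_neg_right, neg_neg]

theorem IsCplx.inner_self (hI : IsCplx I) (a : E) : inner ℝ (I a) a = 0 := by
  have := hI.skew a a
  rw [real_inner_comm] at this
  rw [real_inner_comm]
  linarith

theorem IsCplx.norm_map (hI : IsCplx I) (a : E) : ‖I a‖ = ‖a‖ :=
  norm_map_of_inner_map hI.inner_map a

theorem IsUnitaryFor.norm_map {S : E →L[ℝ] E} (hS : IsUnitaryFor I S) (a : E) : ‖S a‖ = ‖a‖ :=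
  norm_map_of_inner_map hS.inner_map a

theorem IsLagrProj.inner_compl {P : E →L[ℝ] E} (hP : IsLagrProj I P) (a b : E) :
    inner ℝ (P a) (b - P b) = 0 := by
  rw [hP.symm, map_sub, hP.idem, sub_self, inner_zero_right]

theorem IsLagrProj.norm_sq_add {P : E →L[ℝ] E} (hP : IsLagrProj I P) (a : E) :
    ‖a‖ ^ 2 = ‖P a‖ ^ 2 + ‖a - P a‖ ^ 2 := by
  have := norm_add_sq_real (P a) (a - P a)
  rw [hP.inner_compl, add_sub_cancel] at this
  linarith

theorem IsLagrProj.norm_map_le {P : E →L[ℝ] E} (hP : IsLagrProj I P) (a : E) : ‖P a‖ ≤ ‖a‖ := by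
  refine (sq_le_sq₀ (norm_nonneg _) (norm_nonneg _)).1 ?_
  nlinarith [hP.norm_sq_add a, sq_nonneg ‖a - P a‖]

theorem IsLagrProj.norm_compl_le {P : E →L[ℝ] E} (hP : IsLagrProj I P) (a : E) :
    ‖a - P a‖ ≤ ‖a‖ := by
  refine (sq_le_sq₀ (norm_nonneg _) (norm_nonneg _)).1 ?_
  nlinarith [hP.norm_sq_add a, sq_nonneg ‖P a‖]

/-- The operator `S` followed by the rotation `e^{-Iθ}`. -/
noncomputable def rotOp (I S : E →L[ℝ] E) (θ : ℝ) : E →L[ℝ] E := Real.cos θ • S - Real.sin θ • I ∘L S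

theorem rotOp_apply (I S : E →L[ℝ] E) (θ : ℝ) (a : E) :
    rotOp I S θ a = Real.cos θ • S a - Real.sin θ • I (S a) := rfl

theorem rotOp_zero (I S : E →L[ℝ] E) : rotOp I S 0 = S := by simp [rotOp]

theorem continuous_rotOp (I S : E →L[ℝ] E) : Continuous (rotOp I S) := by
  unfold rotOp; fun_prop

theorem IsUnitaryFor.rotOp (hI : IsCplx I) {S : E →L[ℝ] E} (hS : IsUnitaryFor I S) (θ : ℝ) :
    IsUnitaryFor I (rotOp I S θ) where
  inner_map a b := by
    simp only [rotOp_apply, inner_sub_left, inner_sub_right, real_inner_smul_left,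
      real_inner_smul_right, hI.inner_map, hS.inner_map, hI.skew]
    linear_combination (inner ℝ a b) * Real.sin_sq_add_cos_sq θ
  comm a := by simp [rotOp_apply, hS.comm]

theorem norm_rotOp_sub_le (hI : IsCplx I) {S : E →L[ℝ] E} (hS : IsUnitaryFor I S) {θ : ℝ}
    (hθ : 0 ≤ θ) : ‖rotOp I S θ - S‖ ≤ θ := by
  refine ContinuousLinearMap.opNorm_le_bound _ hθ fun a => ?_
  have h1 : (rotOp I S θ - S) a = (Real.cos θ - 1) • S a - Real.sin θ • I (S a) := by
    rw [sub_apply, rotOp_apply, sub_smul, one_smul]; abel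
  have h2 : ‖(rotOp I S θ - S) a‖ ^ 2 = (2 - 2 * Real.cos θ) * ‖a‖ ^ 2 := by
    rw [h1, norm_sub_sq_real, norm_smul, norm_smul, mul_pow, mul_pow, hI.norm_map, hS.norm_map,
      real_inner_smul_left, real_inner_smul_right, real_inner_comm, hI.inner_self,
      Real.norm_eq_abs, Real.norm_eq_abs, sq_abs, sq_abs]
    linear_combination ‖a‖ ^ 2 * Real.sin_sq_add_cos_sq θ
  refine (sq_le_sq₀ (norm_nonneg _) (by positivity)).1 ?_
  rw [h2, mul_pow]
  exact mul_le_mul_of_nonneg_right (by linarith [Real.one_sub_sq_div_two_le_cos (x := θ)])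
    (sq_nonneg _)

theorem norm_compl_rotOp_le (hI : IsCplx I) {S P : E →L[ℝ] E}
    (hS : IsUnitaryFor I S)
    (hP : IsLagrProj I P)
    (hclose : ∀ a, ‖S (P a) - P (S (P a))‖ ≤ 1 / 2 * ‖a‖) {θ : ℝ} (hθ : θ ∈ Icc (0 : ℝ) (1 / 4))
    (a : E) : ‖rotOp I S θ (P a) - P (rotOp I S θ (P a))‖ ≤ 3 / 4 * ‖a‖ := by
  have e : rotOp I S θ (P a) - P (rotOp I S θ (P a)) =
      ((rotOp I S θ - S) (P a) - P ((rotOp I S θ - S) (P a))) + (S (P a) - P (S (P a))) := by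
    simp only [sub_apply, map_sub]; abel
  rw [e]
  have h1 := hP.norm_compl_le ((rotOp I S θ - S) (P a))
  have h2 := (rotOp I S θ - S).le_of_opNorm_le (norm_rotOp_sub_le hI hS hθ.1) (P a)
  have h3 := mul_le_mul hθ.2 (hP.norm_map_le a) (norm_nonneg _) (by norm_num)
  linarith [norm_add_le ((rotOp I S θ - S) (P a) - P ((rotOp I S θ - S) (P a)))
    (S (P a) - P (S (P a))), hclose a]

end Cplx

variable [FiniteDimensional ℝ E]

open ContinuousLinearMap in
/-- The Hessian of the finite reduction, with the complex structure `I`, the operator `S` that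
shifts the indices and applies the flow for the time `1 / r`, and the projection `P` onto the
product of the Lagrangian subspaces. -/
noncomputable def hessOp (I S P : E →L[ℝ] E) : E →L[ℝ] E :=
  -(I ∘L (adjoint S ∘L (.id ℝ E - P) + P) ∘L (S - .id ℝ E))

section Hess

variable {I S P : E →L[ℝ] E}

theorem hessOp_apply (I S P : E →L[ℝ] E) (z : E) : hessOp I S P z =
    -I (ContinuousLinearMap.adjoint S ((S z - z) - P (S z - z)) + P (S z - z)) := rfl

/-- The bilinear form of the Hessian, without the adjoint of `S`. -/
theorem inner_hessOp (hI : IsCplx I) (hS : IsUnitaryFor I S) (z w : E) :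
    inner ℝ (hessOp I S P z) w =
      inner ℝ z (I w) - inner ℝ z (I (S w)) - inner ℝ (P (S z - z)) (I (S w - w)) := by
  rw [hessOp_apply, inner_neg_left, hI.skew, neg_neg, inner_add_left,
    ContinuousLinearMap.adjoint_inner_left, hS.comm, inner_sub_left (S z - z), inner_sub_left (S z),
    ← hS.comm, hS.inner_map, hS.comm, map_sub I, inner_sub_right]
  ring

/-- The quadratic form of the Hessian. -/
theorem inner_hessOp_self (hI : IsCplx I) (hS : IsUnitaryFor I S) (z : E) :
    inner ℝ (hessOp I S P z) z =
      inner ℝ (I z) (S z) + inner ℝ (I (P (S z - z))) (S z - z) := by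
  rw [inner_hessOp hI hS, hI.skew, hI.skew, real_inner_comm, hI.inner_self]
  ring

theorem hessOp_isSymmetric (hI : IsCplx I) (hS : IsUnitaryFor I S) (hP : IsLagrProj I P) :
    (hessOp I S P : E →ₗ[ℝ] E).IsSymmetric := by
  intro z w
  change inner ℝ (hessOp I S P z) w = inner ℝ z (hessOp I S P w)
  rw [real_inner_comm (hessOp I S P w), inner_hessOp hI hS, inner_hessOp hI hS]
  have h1 : inner ℝ (P (S w - w)) (I (S z - z)) =
      inner ℝ (S w - w) (I (S z - z)) + inner ℝ (P (S z - z)) (I (S w - w)) := by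
    have h2 : P (I (S z - z)) = I (S z - z) - I (P (S z - z)) := by rw [hP.comm]; abel
    rw [hP.symm, h2, inner_sub_right, real_inner_comm (I (P (S z - z))), hI.skew]
    ring
  have h3 : inner ℝ (S w - w) (I (S z - z)) = inner ℝ w (I z) - inner ℝ (S w) (I z)
      - inner ℝ w (I (S z)) + inner ℝ w (I z) := by
    rw [map_sub, inner_sub_left, inner_sub_right, inner_sub_right, ← hS.comm, hS.inner_map]
    ring
  have h4 : inner ℝ w (I z) = -inner ℝ z (I w) := by rw [real_inner_comm, hI.skew]
  have h5 : inner ℝ (S w) (I z) = -inner ℝ z (I (S w)) := by rw [real_inner_comm, hI.skew]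
  rw [h1, h3, h4, h5]
  ring

theorem norm_hessOp_apply_le (hI : IsCplx I) (hS : IsUnitaryFor I S) (hP : IsLagrProj I P)
    (z : E) : ‖hessOp I S P z‖ ≤ 2 * ‖S z - z‖ := by
  have hS' : ‖ContinuousLinearMap.adjoint S‖ ≤ 1 := by
    rw [LinearIsometryEquiv.norm_map]
    exact opNorm_le_one_of_norm_map_le fun a => (hS.norm_map a).le
  rw [hessOp_apply, norm_neg, hI.norm_map]
  refine (norm_add_le _ _).trans ?_
  have h1 := (ContinuousLinearMap.adjoint S).le_of_opNorm_le hS' ((S z - z) - P (S z - z))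
  linarith [hP.norm_compl_le (S z - z), hP.norm_map_le (S z - z)]

/-- If `S` moves the range of `P` only by a limited angle, then the components `S* (u - P u)` and
`P u` of the gradient, where `u = S z - z`, cannot cancel, and the Hessian is bounded below by the
difference operator `S - 1`. -/
theorem le_norm_hessOp_apply (hI : IsCplx I) (hP : IsLagrProj I P)
    (hS : IsUnitaryFor I S) (h : ∀ a, ‖S (P a) - P (S (P a))‖ ≤ 3 / 4 * ‖a‖) (z : E) :
    1 / 2 * ‖S z - z‖ ≤ ‖hessOp I S P z‖ := by
  set u := S z - z with hu
  set b := u - P u with hb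
  have hSb : ‖b‖ ^ 2 ≤ ‖ContinuousLinearMap.adjoint S b‖ ^ 2 := by
    have hsurj : Function.Surjective S := by
      have hi : Function.Injective (S : E →ₗ[ℝ] E) := by
        rw [← LinearMap.ker_eq_bot, LinearMap.ker_eq_bot']
        intro v hv
        have : ‖S v‖ = 0 := by rw [show S v = 0 from hv, norm_zero]
        rwa [hS.norm_map, norm_eq_zero] at this
      exact LinearMap.injective_iff_surjective.1 hi
    obtain ⟨c, hc⟩ := hsurj b
    have : ContinuousLinearMap.adjoint S b = c := by
      refine ext_inner_right ℝ fun w => ?_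
      rw [ContinuousLinearMap.adjoint_inner_left, ← hc, hS.inner_map]
    rw [this, ← hc, hS.norm_map]
  have hin : |inner ℝ (ContinuousLinearMap.adjoint S b) (P u)| ≤ 3 / 4 * ‖b‖ * ‖P u‖ := by
    have e : inner ℝ (ContinuousLinearMap.adjoint S b) (P u) =
        inner ℝ b (S (P (P u)) - P (S (P (P u)))) := by
      have hPb : P b = 0 := by rw [hb, map_sub, hP.idem, sub_self]
      rw [ContinuousLinearMap.adjoint_inner_left, inner_sub_right, ← hP.symm b, hP.idem, hPb,
        inner_zero_left, sub_zero]
    rw [e]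
    calc _ ≤ ‖b‖ * ‖S (P (P u)) - P (S (P (P u)))‖ := abs_real_inner_le_norm _ _
      _ ≤ ‖b‖ * (3 / 4 * ‖P u‖) := mul_le_mul_of_nonneg_left (h _) (norm_nonneg _)
      _ = _ := by ring
  have hsq : ‖hessOp I S P z‖ ^ 2 = ‖ContinuousLinearMap.adjoint S b‖ ^ 2
      + 2 * inner ℝ (ContinuousLinearMap.adjoint S b) (P u) + ‖P u‖ ^ 2 := by
    rw [hessOp_apply, norm_neg, hI.norm_map, norm_add_sq_real]
  have hu2 := hP.norm_sq_add u
  refine (sq_le_sq₀ (by positivity) (norm_nonneg _)).1 ?_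
  rw [hsq, mul_pow, hu2]
  nlinarith [(abs_le.1 hin).1, sq_nonneg (‖b‖ - ‖P u‖)]

theorem ker_hessOp (hI : IsCplx I) (hP : IsLagrProj I P)
    (hS : IsUnitaryFor I S) (h : ∀ a, ‖S (P a) - P (S (P a))‖ ≤ 3 / 4 * ‖a‖) :
    LinearMap.ker (hessOp I S P : E →ₗ[ℝ] E) =
      LinearMap.ker ((S - .id ℝ E : E →L[ℝ] E) : E →ₗ[ℝ] E) := by
  ext z
  change hessOp I S P z = 0 ↔ S z - z = 0
  constructor
  · intro hz
    have := le_norm_hessOp_apply hI hP hS h z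
    rw [hz, norm_zero] at this
    exact norm_eq_zero.1 (le_antisymm (by linarith) (norm_nonneg _))
  · intro hz
    rw [hessOp_apply, hz]
    simp

theorem norm_hessOp_sub_le {S' : E →L[ℝ] E} (hI : IsCplx I) (hP : IsLagrProj I P)
    (hS : IsUnitaryFor I S) (hS' : IsUnitaryFor I S') :
    ‖hessOp I S' P - hessOp I S P‖ ≤ 4 * ‖S' - S‖ := by
  refine ContinuousLinearMap.opNorm_le_bound _ (by positivity) fun z => ?_
  have e : (hessOp I S' P - hessOp I S P) z =
      -I (ContinuousLinearMap.adjoint (S' - S) ((S' z - z) - P (S' z - z)) +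
        (ContinuousLinearMap.adjoint S ((S' - S) z - P ((S' - S) z)) + P ((S' - S) z))) := by
    rw [sub_apply, hessOp_apply, hessOp_apply, ← neg_sub_neg, neg_neg, neg_neg, ← map_sub, ← map_neg]
    congr 1
    simp only [map_sub, sub_apply]
    abel
  have hadj : ‖ContinuousLinearMap.adjoint S‖ ≤ 1 := by
    rw [LinearIsometryEquiv.norm_map]
    exact opNorm_le_one_of_norm_map_le fun a => (hS.norm_map a).le
  have hz : ‖(S' - S) z‖ ≤ ‖S' - S‖ * ‖z‖ := (S' - S).le_opNorm z
  have h1 := (ContinuousLinearMap.adjoint (S' - S)).le_opNorm ((S' z - z) - P (S' z - z))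
  rw [LinearIsometryEquiv.norm_map] at h1
  have h2 := (ContinuousLinearMap.adjoint S).le_of_opNorm_le hadj ((S' - S) z - P ((S' - S) z))
  have h3 : ‖(S' z - z) - P (S' z - z)‖ ≤ 2 * ‖z‖ := by
    refine (hP.norm_compl_le _).trans ((norm_sub_le _ _).trans ?_)
    rw [hS'.norm_map]; linarith
  rw [e, norm_neg, hI.norm_map]
  refine (norm_add_le _ _).trans ((add_le_add_right (norm_add_le _ _) _).trans ?_)
  have h4 := hP.norm_compl_le ((S' - S) z)
  have h5 := hP.norm_map_le ((S' - S) z)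
  have h6 := mul_le_mul_of_nonneg_left h3 (norm_nonneg (S' - S))
  linarith

end Hess

/-- A linear map on a Euclidean space is bounded below on the orthogonal complement of its
kernel. -/
theorem exists_pos_mul_norm_le (U : E →L[ℝ] E) :
    ∃ c > 0, ∀ v ∈ (LinearMap.ker (U : E →ₗ[ℝ] E))ᗮ, c * ‖v‖ ≤ ‖U v‖ := by
  set K := (LinearMap.ker (U : E →ₗ[ℝ] E))ᗮ with hK
  have hker : LinearMap.ker ((U : E →ₗ[ℝ] E).domRestrict K) = ⊥ := by
    rw [LinearMap.ker_eq_bot']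
    intro v hv
    have h1 : (v : E) ∈ LinearMap.ker (U : E →ₗ[ℝ] E) := hv
    have h2 : inner ℝ (v : E) v = 0 := (Submodule.mem_orthogonal _ _).1 v.2 _ h1
    exact Subtype.ext (inner_self_eq_zero.1 h2)
  obtain ⟨c, hc, hL⟩ := LinearMap.exists_antilipschitzWith _ hker
  refine ⟨(c : ℝ)⁻¹, by positivity, fun v hv => ?_⟩
  have := hL.le_mul_dist ⟨v, hv⟩ 0
  rw [dist_zero_right, map_zero, dist_zero_right] at this
  have h1 : ‖v‖ ≤ c * ‖U v‖ := this
  rw [inv_mul_le_iff₀ (by positivity)]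
  exact h1

end Operators

/-! ### Rotating the Hessian -/

section Rotation

theorem starProjection_sup_of_isOrtho {E : Type*} [NormedAddCommGroup E] [InnerProductSpace ℝ E]
    [FiniteDimensional ℝ E] {U W : Submodule ℝ E} (h : U ⟂ W) :
    (U ⊔ W).starProjection = U.starProjection + W.starProjection := by
  ext v
  refine Submodule.eq_starProjection_of_mem_of_inner_eq_zero ?_ ?_
  · exact Submodule.add_mem_sup (Submodule.starProjection_apply_mem _ _)
      (Submodule.starProjection_apply_mem _ _)
  · intro w hw
    obtain ⟨a, ha, b, hb, rfl⟩ := Submodule.mem_sup.1 hw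
    have h1 := Submodule.starProjection_inner_eq_zero v a ha
    have h2 := Submodule.starProjection_inner_eq_zero v b hb
    have h3 : inner ℝ (W.starProjection v) a = 0 :=
      Submodule.isOrtho_iff_inner_eq.1 h.symm _ (Submodule.starProjection_apply_mem _ _) _ ha
    have h4 : inner ℝ (U.starProjection v) b = 0 :=
      Submodule.isOrtho_iff_inner_eq.1 h _ (Submodule.starProjection_apply_mem _ _) _ hb
    simp only [add_apply, inner_add_right, inner_sub_left, inner_add_left] at *
    linarith

variable {X E : Type*} [NormedAddCommGroup E] [InnerProductSpace ℝ E]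
  [FiniteDimensional ℝ E] {I S : E →L[ℝ] E} {P : X → E →L[ℝ] E}

/-- For small rotations, the Hessians have a spectral gap that is independent of the Lagrangian
subspaces. -/
theorem exists_hasGap_hessOp (hI : IsCplx I) (hS : IsUnitaryFor I S)
    (hP : ∀ x, IsLagrProj I (P x))
    (hclose : ∀ x a, ‖S (P x a) - P x (S (P x a))‖ ≤ 1 / 2 * ‖a‖) {θ : ℝ}
    (hθ : θ ∈ Icc (0 : ℝ) (1 / 4)) :
    ∃ g > 0, ∀ x, HasGap g (hessOp I (rotOp I S θ) (P x)) := by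
  obtain ⟨c, hc, h⟩ := exists_pos_mul_norm_le (rotOp I S θ - .id ℝ E)
  have hS' := hS.rotOp hI θ
  refine ⟨c / 2, by positivity, fun x => ⟨hessOp_isSymmetric hI hS' (hP x), fun v hv => ?_⟩⟩
  have hx := norm_compl_rotOp_le hI hS (hP x) (hclose x) hθ
  rw [ker_hessOp hI (hP x) hS' hx] at hv
  have h1 := h v hv
  have h2 := le_norm_hessOp_apply hI (hP x) hS' hx v
  have h3 : (rotOp I S θ - .id ℝ E) v = rotOp I S θ v - v := rfl
  rw [h3] at h1
  linarith

/-- The rotation makes the form negative on the kernel of the unrotated Hessian, with a rate that is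
linear in the angle. -/
theorem inner_hessOp_rotOp_le (hI : IsCplx I) (hS : IsUnitaryFor I S) {P : E →L[ℝ] E}
    (hP : IsLagrProj I P) {θ : ℝ} (hθ : θ ∈ Icc (0 : ℝ) (1 / 4)) {z : E} (hz : S z = z) :
    inner ℝ (hessOp I (rotOp I S θ) P z) z ≤ -(θ / 2) * ‖z‖ ^ 2 := by
  have hu : ‖rotOp I S θ z - z‖ ≤ θ * ‖z‖ := by
    have := (rotOp I S θ - S).le_of_opNorm_le (norm_rotOp_sub_le hI hS hθ.1) z
    rwa [sub_apply, hz] at this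
  have h1 : inner ℝ (I (P (rotOp I S θ z - z))) (rotOp I S θ z - z) ≤ (θ * ‖z‖) ^ 2 := by
    calc _ ≤ ‖I (P (rotOp I S θ z - z))‖ * ‖rotOp I S θ z - z‖ := real_inner_le_norm _ _
      _ ≤ ‖rotOp I S θ z - z‖ * ‖rotOp I S θ z - z‖ := by
        rw [hI.norm_map]
        exact mul_le_mul_of_nonneg_right (hP.norm_map_le _) (norm_nonneg _)
      _ ≤ (θ * ‖z‖) ^ 2 := by rw [← sq]; exact pow_le_pow_left₀ (norm_nonneg _) hu 2
  have h2 : inner ℝ (I z) (rotOp I S θ z) = -Real.sin θ * ‖z‖ ^ 2 := by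
    rw [rotOp_apply, hz, inner_sub_right, real_inner_smul_right, real_inner_smul_right,
      hI.inner_self, hI.inner_map, real_inner_self_eq_norm_sq]
    ring
  have hsin : 3 / 4 * θ ≤ Real.sin θ := by
    rcases hθ.1.eq_or_lt with h0 | h0
    · rw [← h0]; simp
    · have h4 := Real.sin_gt_sub_cube h0
      have h5 : θ ^ 2 ≤ 1 / 16 := by nlinarith [hθ.1, hθ.2]
      nlinarith
  rw [inner_hessOp_self hI (hS.rotOp hI θ), h2]
  have h6 : 0 ≤ ‖z‖ ^ 2 := sq_nonneg _
  have h7 : -Real.sin θ + θ ^ 2 ≤ -(θ / 2) := by nlinarith [hθ.1, hθ.2]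
  nlinarith

variable [TopologicalSpace X]

theorem continuous_hessOp (hP : Continuous P) : Continuous fun x => hessOp I S (P x) := by
  unfold hessOp
  exact (continuous_const.clm_comp (((continuous_const.clm_comp (continuous_const.sub hP)).add
    hP).clm_comp continuous_const)).neg

/-- For a very small rotation, the kernel of the unrotated Hessian becomes negative, and the rest of
the spectrum keeps its sign. -/
theorem bundleIso_sup_ker_of_small (hI : IsCplx I) (hS : IsUnitaryFor I S) (hPc : Continuous P)
    (hP : ∀ x, IsLagrProj I (P x))
    (hclose : ∀ x a, ‖S (P x a) - P x (S (P x a))‖ ≤ 1 / 2 * ‖a‖) {g : ℝ}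
    (hgap : ∀ x, HasGap g (hessOp I S (P x))) {θ : ℝ}
    (hθ : θ ∈ Ioc (0 : ℝ) (1 / 4)) (hθg : 64 * θ ≤ g) :
    BundleIso (fun x => negSpace (hessOp I S (P x)) ⊔
        LinearMap.ker ((S - .id ℝ E : E →L[ℝ] E) : E →ₗ[ℝ] E))
      fun x => negSpace (hessOp I (rotOp I S θ) (P x)) := by
  have hθ' : θ ∈ Icc (0 : ℝ) (1 / 4) := ⟨hθ.1.le, hθ.2⟩
  have hg : 0 < g := by linarith [hθ.1]
  set K := LinearMap.ker ((S - .id ℝ E : E →L[ℝ] E) : E →ₗ[ℝ] E) with hK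
  obtain ⟨g', hg', hgap'⟩ := exists_hasGap_hessOp hI hS hP hclose hθ'
  have hker : ∀ x, LinearMap.ker (hessOp I S (P x) : E →ₗ[ℝ] E) = K := fun x =>
    ker_hessOp hI (hP x) hS fun a => (hclose x a).trans (by nlinarith [norm_nonneg a])
  have hortho : ∀ x, negSpace (hessOp I S (P x)) ⟂ K := by
    intro x
    rw [← hker x]
    exact isOrtho_negSpace_ker (hgap x).1
  have hdiff : ∀ x, ‖hessOp I (rotOp I S θ) (P x) - hessOp I S (P x)‖ ≤ 4 * θ := fun x =>
    (norm_hessOp_sub_le hI (hP x) hS (hS.rotOp hI θ)).trans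
      (mul_le_mul_of_nonneg_left (norm_rotOp_sub_le hI hS hθ.1.le) (by norm_num))
  refine bundleIso_negSpace hg' (continuous_hessOp hPc) hgap' ?_ ?_ ?_
  · have e : (fun x => (negSpace (hessOp I S (P x)) ⊔ K).starProjection) =
        fun x => (negSpace (hessOp I S (P x))).starProjection + K.starProjection :=
      funext fun x => starProjection_sup_of_isOrtho (hortho x)
    rw [e]
    exact (continuous_starProjection_negSpace hg (continuous_hessOp hPc) hgap).add continuous_const
  · intro x v hv hne
    obtain ⟨n, hn, z, hz, rfl⟩ := Submodule.mem_sup.1 hv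
    have hSz : S z = z := sub_eq_zero.1 hz
    set T := hessOp I (rotOp I S θ) (P x) with hT
    have h1 : inner ℝ (T n) n ≤ (-g + 4 * θ) * ‖n‖ ^ 2 := by
      have a1 := (hgap x).inner_le hn
      have a2 := (abs_le.1 (abs_inner_sub_le (hessOp I S (P x)) T n)).2
      have a3 := mul_le_mul_of_nonneg_right (hdiff x) (sq_nonneg ‖n‖)
      linarith
    have h2 : inner ℝ (T z) z ≤ -(θ / 2) * ‖z‖ ^ 2 := inner_hessOp_rotOp_le hI hS (hP x) hθ' hSz
    have h3 : inner ℝ (T z) n ≤ 2 * θ * ‖z‖ * ‖n‖ := by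
      have b1 := (rotOp I S θ - S).le_of_opNorm_le (norm_rotOp_sub_le hI hS hθ.1.le) z
      rw [sub_apply, hSz] at b1
      have b2 := norm_hessOp_apply_le hI (hS.rotOp hI θ) (hP x) z
      exact (real_inner_le_norm _ _).trans
        (mul_le_mul_of_nonneg_right (by linarith) (norm_nonneg _))
    have h4 : inner ℝ (T n) z = inner ℝ (T z) n := by
      rw [real_inner_comm z]
      exact ((hgap' x).1 z n).symm
    have h5 : 0 < ‖n‖ ^ 2 + ‖z‖ ^ 2 := by
      rcases eq_or_ne n 0 with h0 | h0
      · have : z ≠ 0 := fun h => hne (by rw [h0, h, add_zero])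
        positivity
      · positivity
    rw [map_add, inner_add_left, inner_add_right, inner_add_right, h4]
    have h6 : (-g + 4 * θ) * ‖n‖ ^ 2 ≤ -(60 * θ) * ‖n‖ ^ 2 :=
      mul_le_mul_of_nonneg_right (by linarith) (sq_nonneg _)
    have h7 : 0 < θ * (‖n‖ ^ 2 + ‖z‖ ^ 2) := mul_pos hθ.1 h5
    nlinarith [mul_nonneg hθ.1.le (sq_nonneg (‖z‖ - 10 * ‖n‖))]
  · intro x v hv
    have hv1 : v ∈ (negSpace (hessOp I S (P x)))ᗮ :=
      Submodule.orthogonal_le le_sup_left hv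
    have hv2 : v ∈ (LinearMap.ker (hessOp I S (P x) : E →ₗ[ℝ] E))ᗮ := by
      rw [hker x]
      exact Submodule.orthogonal_le le_sup_right hv
    have a1 := (hgap x).le_inner hv1 hv2
    have a2 := (abs_le.1 (abs_inner_sub_le (hessOp I S (P x)) (hessOp I (rotOp I S θ) (P x)) v)).1
    have a3 := mul_le_mul_of_nonneg_right (hdiff x) (sq_nonneg ‖v‖)
    nlinarith [sq_nonneg ‖v‖]

/-- As long as the rotation has no fixed vectors, the isomorphism class of the negative eigenbundle
does not depend on the angle. -/
theorem bundleIso_of_rotOp (hI : IsCplx I) (hS : IsUnitaryFor I S) (hPc : Continuous P)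
    (hP : ∀ x, IsLagrProj I (P x))
    (hclose : ∀ x a, ‖S (P x a) - P x (S (P x a))‖ ≤ 1 / 2 * ‖a‖) {θ₁ : ℝ} (hθ₁ : θ₁ ≤ 1 / 4)
    (hker : ∀ θ ∈ Ioc 0 θ₁, ∀ v, rotOp I S θ v = v → v = 0) {θ θ' : ℝ} (hθ : θ ∈ Ioc 0 θ₁)
    (hθ' : θ' ∈ Ioc 0 θ₁) :
    BundleIso (fun x => negSpace (hessOp I (rotOp I S θ) (P x)))
      fun x => negSpace (hessOp I (rotOp I S θ') (P x)) := by
  have hIcc : ∀ {θ}, θ ∈ Ioc 0 θ₁ → θ ∈ Icc (0 : ℝ) (1 / 4) := fun h => ⟨h.1.le, h.2.trans hθ₁⟩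
  refine isPreconnected_Ioc.induction₂ (fun θ θ' : ℝ =>
    BundleIso (fun x => negSpace (hessOp I (rotOp I S θ) (P x)))
      fun x => negSpace (hessOp I (rotOp I S θ') (P x))) ?_ (fun _ _ _ _ _ _ h h' => h.trans h')
      (fun _ _ _ _ h => h.symm) hθ hθ'
  intro θ hθ
  obtain ⟨g, hg, hgap⟩ := exists_hasGap_hessOp hI hS hP hclose (hIcc hθ)
  have hc : Continuous fun θ' => 4 * ‖rotOp I S θ' - rotOp I S θ‖ :=
    continuous_const.mul ((continuous_rotOp I S).sub continuous_const).norm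
  have hev : ∀ᶠ θ' in 𝓝[Ioc 0 θ₁] θ, 4 * ‖rotOp I S θ' - rotOp I S θ‖ < g :=
    (hc.continuousAt.eventually_lt continuousAt_const (by simpa using hg)).filter_mono
      nhdsWithin_le_nhds
  filter_upwards [hev, self_mem_nhdsWithin] with θ' hlt hθ'
  obtain ⟨g', hg', hgap'⟩ := exists_hasGap_hessOp hI hS hP hclose (hIcc hθ')
  refine bundleIso_negSpace_of_norm_sub_lt hg hg' (continuous_hessOp hPc) (continuous_hessOp hPc)
    hgap hgap' (fun x => ?_) fun x => (norm_hessOp_sub_le hI (hP x) (hS.rotOp hI θ)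
      (hS.rotOp hI θ')).trans_lt hlt
  rw [ker_hessOp hI (hP x) (hS.rotOp hI θ) (norm_compl_rotOp_le hI hS (hP x) (hclose x) (hIcc hθ)),
    LinearMap.ker_eq_bot']
  exact fun v hv => hker θ hθ v (sub_eq_zero.1 hv)

/-- The negative eigenbundle of the rotated Hessian is the sum of that of the unrotated Hessian and
the trivial bundle of the kernel. -/
theorem bundleIso_sup_ker (hI : IsCplx I) (hS : IsUnitaryFor I S) (hPc : Continuous P)
    (hP : ∀ x, IsLagrProj I (P x))
    (hclose : ∀ x a, ‖S (P x a) - P x (S (P x a))‖ ≤ 1 / 2 * ‖a‖) {θ₁ : ℝ} (h0 : 0 < θ₁)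
    (hθ₁ : θ₁ ≤ 1 / 4) (hker : ∀ θ ∈ Ioc 0 θ₁, ∀ v, rotOp I S θ v = v → v = 0) :
    BundleIso (fun x => negSpace (hessOp I (rotOp I S θ₁) (P x)))
      fun x => negSpace (hessOp I S (P x)) ⊔
        LinearMap.ker ((S - .id ℝ E : E →L[ℝ] E) : E →ₗ[ℝ] E) := by
  obtain ⟨g, hg, hgap⟩ := exists_hasGap_hessOp hI hS hP hclose (θ := 0) (by simp)
  simp only [rotOp_zero] at hgap
  have hm : min (g / 64) θ₁ ∈ Ioc 0 θ₁ := ⟨by positivity, min_le_right _ _⟩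
  refine (bundleIso_of_rotOp hI hS hPc hP hclose hθ₁ hker (right_mem_Ioc.2 h0) hm).trans
    (bundleIso_sup_ker_of_small hI hS hPc hP hclose hgap ⟨hm.1, hm.2.trans hθ₁⟩ ?_).symm
  linarith [min_le_left (g / 64) θ₁]

theorem continuous_starProjection_negSpace_hessOp (hI : IsCplx I) (hS : IsUnitaryFor I S)
    (hPc : Continuous P) (hP : ∀ x, IsLagrProj I (P x))
    (hclose : ∀ x a, ‖S (P x a) - P x (S (P x a))‖ ≤ 1 / 2 * ‖a‖) {θ : ℝ}
    (hθ : θ ∈ Icc (0 : ℝ) (1 / 4)) :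
    Continuous fun x => (negSpace (hessOp I (rotOp I S θ) (P x))).starProjection := by
  obtain ⟨g, hg, hgap⟩ := exists_hasGap_hessOp hI hS hP hclose hθ
  exact continuous_starProjection_negSpace hg (continuous_hessOp hPc) hgap

/-- The sum with a constant orthogonal summand is isomorphic to the product with a trivial
bundle. -/
theorem bundleIso_sup_prod_top {G : Type*} [NormedAddCommGroup G] [NormedSpace ℝ G]
    [FiniteDimensional ℝ G] {N : X → Submodule ℝ E} {K : Submodule ℝ E}
    (hN : Continuous fun x => (N x).starProjection) (hNK : ∀ x, N x ⟂ K)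
    (hdim : Module.finrank ℝ K = Module.finrank ℝ G) :
    BundleIso (fun x => N x ⊔ K) fun x => (N x).prod (⊤ : Submodule ℝ G) := by
  let e : K ≃L[ℝ] G := ContinuousLinearEquiv.ofFinrankEq hdim
  have hK0 : ∀ x, ∀ n ∈ N x, K.orthogonalProjectionOnto n = 0 := fun x n hn =>
    Submodule.orthogonalProjectionOnto_eq_zero_iff.2 ((hNK x) hn)
  have hN0 : ∀ x, ∀ z ∈ K, (N x).starProjection z = 0 := fun x z hz =>
    (Submodule.starProjection_apply_eq_zero_iff _).2 ((hNK x).symm hz)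
  have hNN : ∀ x, ∀ n ∈ N x, (N x).starProjection n = n := fun x n hn =>
    Submodule.starProjection_eq_self_iff.2 hn
  refine bundleIso_of_inverse
    (fun x => (N x).starProjection.prod ((e : K →L[ℝ] G) ∘L K.orthogonalProjectionOnto))
    (fun _ => (ContinuousLinearMap.id ℝ E).coprod (K.subtypeL ∘L (e.symm : G →L[ℝ] K)))
    ?_ continuous_const ?_ ?_ ?_ ?_
  · exact (ContinuousLinearMap.prodₗᵢ ℝ).continuous.comp (hN.prodMk continuous_const)
  · exact fun x v _ => ⟨Submodule.starProjection_apply_mem _ _, trivial⟩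
  · exact fun x w hw => Submodule.add_mem_sup hw.1 (e.symm w.2).2
  · intro x v hv
    obtain ⟨n, hn, z, hz, rfl⟩ := Submodule.mem_sup.1 hv
    lift z to K using hz
    simp [hNN x n hn, hN0 x z z.2, hK0 x n hn]
  · rintro x ⟨n, y⟩ hw
    have hn : n ∈ N x := hw.1
    simp [hNN x n hn, hN0 x _ (e.symm y).2, hK0 x n hn]

end Rotation

/-! ### The action integral of the finite reduction -/

section Action

variable {k : ℕ}

theorem lam_add_left (a b c : V k) : lam (a + b) c = lam a c + lam b c := by
  simp [lam, add_mul, Finset.sum_add_distrib]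

theorem lam_add_right (a b c : V k) : lam a (b + c) = lam a b + lam a c := by
  simp [lam, mul_add, Finset.sum_add_distrib]

theorem lam_smul_left (s : ℝ) (a b : V k) : lam (s • a) b = s * lam a b := by
  simp [lam, Finset.mul_sum, mul_assoc]

theorem lam_smul_right (s : ℝ) (a b : V k) : lam a (s • b) = s * lam a b := by
  simp [lam, Finset.mul_sum, mul_left_comm]

theorem lam_neg_right (a b : V k) : lam a (-b) = -lam a b := by
  simp [lam]

theorem lam_neg_left (a b : V k) : lam (-a) b = -lam a b := by
  simp [lam]

theorem omega_eq_lam (a b : V k) : omega a b = lam b a - lam a b := by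
  simp only [omega, lam, ← Finset.sum_sub_distrib]
  exact Finset.sum_congr rfl fun i _ => by ring

theorem continuous_lam {c v : ℝ → V k} (hc : Continuous c) (hv : Continuous v) :
    Continuous fun t => lam (c t) (v t) := by
  unfold lam
  fun_prop

/-- The complex structure as an operator. -/
noncomputable def Jop (k : ℕ) : V k →L[ℝ] V k :=
  LinearMap.toContinuousLinearMap
    { toFun := J
      map_add' := fun a b => by ext i; cases i <;> simp [J]; ring
      map_smul' := fun s a => by ext i; cases i <;> simp [J] }

theorem Jop_apply (a : V k) : Jop k a = J a := rfl

theorem inner_J (a b : V k) : inner ℝ (J a) b = omega a b := by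
  simp only [PiLp.inner_apply, Fintype.sum_sum_type, J, omega, Sum.elim_inl, Sum.elim_inr,
    ← Finset.sum_add_distrib]
  refine Finset.sum_congr rfl fun i _ => ?_
  simp
  ring

theorem isCplx_Jop : IsCplx (Jop k) where
  skew a b := by
    rw [Jop_apply, Jop_apply, real_inner_comm (J b), inner_J, inner_J, omega_eq_lam, omega_eq_lam]
    ring
  sq a := by
    ext i
    cases i <;> simp [Jop_apply, J]

theorem lineIntegral_lineMap (a b : V k) :
    lineIntegral (fun t => AffineMap.lineMap a b t) 0 1 =
      lam a (b - a) + 1 / 2 * lam (b - a) (b - a) := by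
  unfold lineIntegral
  have h : ∀ t : ℝ, lam (AffineMap.lineMap a b t) (deriv (fun t => AffineMap.lineMap a b t) t) =
      lam a (b - a) + t * lam (b - a) (b - a) := by
    intro t
    have hd : deriv (fun t : ℝ => AffineMap.lineMap a b t) t = b - a :=
      (AffineMap.hasDerivAt_lineMap (a := a) (b := b) (x := t)).deriv
    rw [hd, AffineMap.lineMap_apply_module', lam_add_left, lam_smul_left]
    ring
  simp only [h]
  rw [intervalIntegral.integral_add (by simp) (by
    exact (continuous_id.mul continuous_const).intervalIntegrable _ _)]
  simp

/-- The action of an `L`-curve is that of the straight segment, `(λ₀(z) z - λ₀(w) w + ω(z, w)) / 2`,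
and the area of the triangle with the corner of the curve. -/
theorem wedgeIntegral_eq (w z : V k) (L : Lagr k) :
    wedgeIntegral w z L = 1 / 2 * (lam z z - lam w w) + 1 / 2 * omega z w
      + 1 / 2 * omega (L.proj (w - z)) (w - z - L.proj (w - z)) := by
  unfold wedgeIntegral
  simp only [lineIntegral_lineMap, omega_eq_lam]
  generalize hp : L.proj (w - z) = p
  obtain ⟨q, rfl⟩ : ∃ q, w = z + p + q := ⟨w - z - p, by abel⟩
  have e1 : z + p - (z + p + q) = -q := by abel
  have e2 : z - (z + p) = -p := by abel
  have e3 : z + p + q - z - p = q := by abel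
  rw [e1, e2, e3]
  simp only [lam_add_left, lam_add_right, lam_neg_left, lam_neg_right]
  ring

/-- The action of a trajectory of the rotation depends only on its endpoints, since the Hamiltonian
is homogeneous of degree two. -/
theorem action_flowHD (z : V k) (T : ℝ) :
    lineIntegral (fun t => flowHD t z) 0 T - ∫ t in (0 : ℝ)..T, HD (flowHD t z) =
      1 / 2 * (lam (flowHD T z) (flowHD T z) - lam z z) := by
  have hd : ∀ t, HasDerivAt (fun u => flowHD u z) (-(2 : ℝ) • J (flowHD t z)) t := by
    intro t
    refine ((isHamFlow_flowHD z).2 t).congr_deriv ?_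
    rw [hamVF, gradient_HD, ← Jop_apply, map_smul, Jop_apply, neg_smul]
  have hc : Continuous fun t => flowHD t z := continuous_iff_continuousAt.2 fun t =>
    (hd t).continuousAt
  have hJc : Continuous fun t => -(2 : ℝ) • J (flowHD t z) := by
    simp only [← Jop_apply]
    fun_prop
  have hH : Continuous fun t => HD (flowHD t z) := (hc.norm.pow 2)
  have hlam : ∀ t, HasDerivAt (fun u => 1 / 2 * lam (flowHD u z) (flowHD u z))
      (lam (flowHD t z) (-(2 : ℝ) • J (flowHD t z)) - HD (flowHD t z)) t := by
    intro t
    have h1 : HasDerivAt (fun u => lam (flowHD u z) (flowHD u z))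
        (lam (-(2 : ℝ) • J (flowHD t z)) (flowHD t z)
          + lam (flowHD t z) (-(2 : ℝ) • J (flowHD t z))) t := by
      unfold lam
      rw [← Finset.sum_add_distrib]
      refine HasDerivAt.fun_sum fun i _ => ?_
      have hcoord : ∀ m : Fin k ⊕ Fin k, HasDerivAt (fun u => flowHD u z m)
          ((-(2 : ℝ) • J (flowHD t z)) m) t := fun m =>
        (EuclideanSpace.proj (𝕜 := ℝ) m).hasFDerivAt.comp_hasDerivAt t (hd t)
      exact (hcoord (Sum.inr i)).mul (hcoord (Sum.inl i))
    refine (h1.const_mul (1 / 2 : ℝ)).congr_deriv ?_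
    have h2 : omega (J (flowHD t z)) (flowHD t z) = -HD (flowHD t z) := by
      rw [← inner_J, ← Jop_apply, ← Jop_apply, isCplx_Jop.sq, inner_neg_left,
        real_inner_self_eq_norm_sq, HD]
    rw [omega_eq_lam] at h2
    simp only [lam_smul_left, lam_smul_right]
    linarith
  have hF := intervalIntegral.integral_eq_sub_of_hasDerivAt (a := 0) (b := T) (fun t _ => hlam t)
    (((continuous_lam hc hJc).sub hH).intervalIntegrable _ _)
  rw [intervalIntegral.integral_sub ((continuous_lam hc hJc).intervalIntegrable _ _)
    (hH.intervalIntegrable _ _)] at hF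
  have h0 : flowHD 0 z = z := (isHamFlow_flowHD z).1
  simp only [h0] at hF
  have hl : lineIntegral (fun t => flowHD t z) 0 T =
      ∫ t in (0 : ℝ)..T, lam (flowHD t z) (-(2 : ℝ) • J (flowHD t z)) := by
    unfold lineIntegral
    simp only [(hd _).deriv]
  rw [hl, hF]
  ring

/-- If the action of the trajectories depends only on the endpoints in the homogeneous manner, then
the boundary terms of the finite reduction cancel in the cyclic sum. -/
theorem finRed_eq {r : ℕ} [NeZero r] (H : V k → ℝ) (φ : ℝ → V k → V k)
    (hφ : ∀ z T, lineIntegral (fun t => φ t z) 0 T - ∫ t in (0 : ℝ)..T, H (φ t z) =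
      1 / 2 * (lam (φ T z) (φ T z) - lam z z)) (L : ZMod r → Lagr k) (z : ZMod r → V k) :
    finRed H φ L z = 1 / 2 * ∑ j : ZMod r, (omega (z j) (φ (1 / r) (z (j - 1)))
      + omega ((L j).proj (φ (1 / r) (z (j - 1)) - z j))
        (φ (1 / r) (z (j - 1)) - z j - (L j).proj (φ (1 / r) (z (j - 1)) - z j))) := by
  unfold finRed
  simp only [hφ, wedgeIntegral_eq]
  have hshift : ∑ j : ZMod r, lam (φ (1 / r) (z (j - 1))) (φ (1 / r) (z (j - 1))) =
      ∑ j : ZMod r, lam (φ (1 / r) (z j)) (φ (1 / r) (z j)) :=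
    Equiv.sum_comp (Equiv.subRight (1 : ZMod r)) fun j => lam (φ (1 / r) (z j)) (φ (1 / r) (z j))
  simp only [mul_sub, Finset.sum_add_distrib, Finset.sum_sub_distrib, ← Finset.mul_sum, mul_add,
    hshift]
  ring

end Action

/-! ### The finite reduction as a quadratic form -/

section Reduction

variable {k r : ℕ}

/-- The operator on `(ℝ^{2k})^r` that applies `A j` to the component `j`. -/
noncomputable def diagOp (A : ZMod r → V k →L[ℝ] V k) : VR k r →L[ℝ] VR k r :=
  (PiLp.continuousLinearEquiv 2 ℝ fun _ : ZMod r => V k).symm.toContinuousLinearMap ∘L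
    ContinuousLinearMap.pi fun j => A j ∘L PiLp.proj 2 (fun _ : ZMod r => V k) j

@[simp] theorem diagOp_apply (A : ZMod r → V k →L[ℝ] V k) (z : VR k r) (j : ZMod r) :
    diagOp A z j = A j (z j) := rfl

variable [NeZero r]

/-- The operator on `(ℝ^{2k})^r` that shifts the components cyclically. -/
noncomputable def shiftOp (k r : ℕ) [NeZero r] : VR k r →L[ℝ] VR k r :=
  (PiLp.continuousLinearEquiv 2 ℝ fun _ : ZMod r => V k).symm.toContinuousLinearMap ∘L
    ContinuousLinearMap.pi fun j => PiLp.proj 2 (fun _ : ZMod r => V k) (j - 1)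

@[simp] theorem shiftOp_apply (z : VR k r) (j : ZMod r) : shiftOp k r z j = z (j - 1) := rfl

theorem continuous_diagOp {X : Type*} [TopologicalSpace X] {A : X → ZMod r → V k →L[ℝ] V k}
    (hA : ∀ j, Continuous fun x => A x j) : Continuous fun x => diagOp (A x) := by
  rw [continuous_clm_apply]
  intro z
  exact (PiLp.continuous_toLp 2 _).comp
    (continuous_pi fun j => (hA j).clm_apply continuous_const)

theorem isCplx_diagOp : IsCplx (diagOp fun _ : ZMod r => Jop k) where
  skew a b := by
    simp only [PiLp.inner_apply, diagOp_apply,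
      isCplx_Jop.skew, Finset.sum_neg_distrib]
  sq a := by
    ext1 j
    exact isCplx_Jop.sq (a j)

theorem isUnitaryFor_shiftOp : IsUnitaryFor (diagOp fun _ : ZMod r => Jop k) (shiftOp k r) where
  inner_map a b := by
    simp only [PiLp.inner_apply, shiftOp_apply]
    exact Equiv.sum_comp (Equiv.subRight (1 : ZMod r)) fun j => inner ℝ (a j) (b j)
  comm a := rfl

/-- The complex structure exchanges a Lagrangian subspace with its orthogonal complement. -/
theorem Lagr.isLagrProj (L : Lagr k) : IsLagrProj (Jop k) L.proj := by
  have hJL : ∀ u ∈ L.1, Jop k u ∈ L.1ᗮ := fun u hu => by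
    rw [Submodule.mem_orthogonal']
    intro v hv
    rw [Jop_apply, inner_J]
    exact L.2.1 u hu v hv
  have hinj : Function.Injective (Jop k : V k →ₗ[ℝ] V k) := fun a b h => by
    have : Jop k (Jop k a) = Jop k (Jop k b) := congrArg _ h
    simpa only [isCplx_Jop.sq, neg_inj] using this
  have hmap : L.1.map (Jop k : V k →ₗ[ℝ] V k) = L.1ᗮ := by
    refine Submodule.eq_of_le_of_finrank_eq ?_ ?_
    · rintro _ ⟨u, hu, rfl⟩
      exact hJL u hu
    · rw [← LinearEquiv.finrank_eq (Submodule.equivMapOfInjective _ hinj L.1)]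
      have h1 := L.1.finrank_add_finrank_orthogonal
      have h2 : Module.finrank ℝ (V k) = k + k := by simp [V]
      have h3 := L.2.2
      omega
  have hJL' : ∀ u ∈ L.1ᗮ, Jop k u ∈ L.1 := fun u hu => by
    rw [← hmap] at hu
    obtain ⟨v, hv, rfl⟩ := hu
    change Jop k (Jop k v) ∈ L.1
    rw [isCplx_Jop.sq]
    exact Submodule.neg_mem _ hv
  refine ⟨fun a b => Submodule.inner_starProjection_left_eq_right _ _ _,
    fun a => Submodule.starProjection_eq_self_iff.2 (Submodule.starProjection_apply_mem _ _),
    fun a => ?_⟩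
  have h : L.proj (Jop k a) = Jop k (a - L.proj a) := by
    refine Submodule.eq_starProjection_of_mem_of_inner_eq_zero
      (hJL' _ (Submodule.sub_starProjection_mem_orthogonal a)) fun w hw => ?_
    rw [← map_sub, sub_sub_cancel]
    exact (Submodule.mem_orthogonal' _ _).1 (hJL _ (Submodule.starProjection_apply_mem _ _)) w hw
  rw [h, map_sub, sub_sub_cancel]

theorem isLagrProj_diagOp (L : ZMod r → Lagr k) :
    IsLagrProj (diagOp fun _ => Jop k) (diagOp fun j => (L j).proj) where
  symm a b := by
    simp only [PiLp.inner_apply, diagOp_apply,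
      (L _).isLagrProj.symm]
  idem a := by
    ext1 j
    exact (L j).isLagrProj.idem (a j)
  comm a := by
    ext1 j
    exact (L j).isLagrProj.comm (a j)

theorem inner_hessOp_rotOp_self (L : ZMod r → Lagr k) (θ : ℝ) (z : VR k r) :
    inner ℝ (hessOp (diagOp fun _ => Jop k) (rotOp (diagOp fun _ => Jop k) (shiftOp k r) θ)
      (diagOp fun j => (L j).proj) z) z =
    ∑ j : ZMod r, (omega (z j) (Real.cos θ • z (j - 1) - Real.sin θ • J (z (j - 1)))
      + omega ((L j).proj (Real.cos θ • z (j - 1) - Real.sin θ • J (z (j - 1)) - z j))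
        (Real.cos θ • z (j - 1) - Real.sin θ • J (z (j - 1)) - z j
          - (L j).proj (Real.cos θ • z (j - 1) - Real.sin θ • J (z (j - 1)) - z j))) := by
  rw [inner_hessOp_self isCplx_diagOp (isUnitaryFor_shiftOp.rotOp isCplx_diagOp θ),
    PiLp.inner_apply, PiLp.inner_apply, ← Finset.sum_add_distrib]
  refine Finset.sum_congr rfl fun j _ => ?_
  have e : rotOp (diagOp fun _ => Jop k) (shiftOp k r) θ z j =
      Real.cos θ • z (j - 1) - Real.sin θ • J (z (j - 1)) := rfl
  simp only [diagOp_apply, PiLp.sub_apply, e]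
  generalize Real.cos θ • z (j - 1) - Real.sin θ • J (z (j - 1)) = w
  rw [Jop_apply, inner_J, ← inner_J ((L j).proj (w - z j)), inner_sub_right _ (w - z j),
    ← Jop_apply, isCplx_Jop.inner_self, sub_zero]

theorem polar_eq_inner {F : Type*} [NormedAddCommGroup F] [InnerProductSpace ℝ F] {T : F →L[ℝ] F}
    (hT : (T : F →ₗ[ℝ] F).IsSymmetric) (v w : F) :
    QuadraticMap.polar (fun z => 1 / 2 * inner ℝ (T z) z) v w = inner ℝ (T v) w := by
  have h : inner ℝ (T w) v = inner ℝ (T v) w := by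
    rw [real_inner_comm]
    exact (hT v w).symm
  simp only [QuadraticMap.polar, map_add, inner_add_left, inner_add_right, h]
  ring

theorem negEigenspace_formA (L : ZMod r → Lagr k) :
    negEigenspace (formA L) = negSpace (hessOp (diagOp fun _ => Jop k)
      (rotOp (diagOp fun _ => Jop k) (shiftOp k r) (2 / r)) (diagOp fun j => (L j).proj)) := by
  refine negEigenspace_eq_negSpace fun v w => ?_
  rw [← polar_eq_inner (hessOp_isSymmetric isCplx_diagOp
    (isUnitaryFor_shiftOp.rotOp isCplx_diagOp _) (isLagrProj_diagOp L))]
  congr 1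
  funext z
  rw [inner_hessOp_rotOp_self, formA, finRed_eq _ _ action_flowHD]
  simp only [flowHD, mul_one_div]

theorem negEigenspace_formB (L : ZMod r → Lagr k) :
    negEigenspace (formB L) = negSpace (hessOp (diagOp fun _ => Jop k) (shiftOp k r)
      (diagOp fun j => (L j).proj)) := by
  refine negEigenspace_eq_negSpace fun v w => ?_
  rw [← polar_eq_inner (hessOp_isSymmetric isCplx_diagOp isUnitaryFor_shiftOp (isLagrProj_diagOp L))]
  congr 1
  funext z
  rw [← rotOp_zero (diagOp fun _ => Jop k) (shiftOp k r), inner_hessOp_rotOp_self, formB, finRed_eq]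
  · simp
  · intro z T
    simp [lineIntegral, lam]

/-- The rotation of the components has no cyclic fixed vectors, as long as the total angle is less
than a full turn. -/
theorem eq_zero_of_rotOp_eq {θ : ℝ} (h0 : 0 < θ) (h2 : r * θ ≤ 2) {z : VR k r}
    (hz : rotOp (diagOp fun _ => Jop k) (shiftOp k r) θ z = z) : z = 0 := by
  have hstep : ∀ j, z j = Real.cos θ • z (j - 1) - Real.sin θ • J (z (j - 1)) := fun j => by
    conv_lhs => rw [← hz]
    rfl
  have hn : ∀ n : ℕ, z (n : ZMod r) = Real.cos (n * θ) • z 0 - Real.sin (n * θ) • J (z 0) := by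
    intro n
    induction n with
    | zero => simp
    | succ n ih =>
      have hJ : J (z (n : ZMod r)) = Real.cos (n * θ) • J (z 0) + Real.sin (n * θ) • z 0 := by
        rw [ih, ← Jop_apply, map_sub, map_smul, map_smul, ← Jop_apply, isCplx_Jop.sq, Jop_apply,
          smul_neg, sub_neg_eq_add]
      rw [hstep, Nat.cast_succ, add_sub_cancel_right, hJ, ih, Nat.cast_succ, add_mul, one_mul,
        Real.cos_add, Real.sin_add]
      module
  have hr : (0 : ℝ) < r := by exact_mod_cast Nat.pos_of_ne_zero (NeZero.ne r)
  have h00 : z 0 = 0 := by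
    have h := hn r
    rw [ZMod.natCast_self] at h
    have h1 : inner ℝ (z 0) (z 0) = Real.cos (r * θ) * inner ℝ (z 0) (z 0) := by
      have h3 : inner ℝ (J (z 0)) (z 0) = 0 := isCplx_Jop.inner_self (z 0)
      conv_lhs =>
        enter [2]
        rw [h]
      rw [inner_sub_left, real_inner_smul_left, real_inner_smul_left, h3, mul_zero, sub_zero]
    have hcos : Real.cos (r * θ) < 1 := by
      rw [← Real.cos_zero]
      exact Real.cos_lt_cos_of_nonneg_of_le_pi le_rfl (by linarith [Real.pi_gt_three])
        (by positivity)
    have h4 : (1 - Real.cos (r * θ)) * inner ℝ (z 0) (z 0) = 0 := by linarith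
    exact inner_self_eq_zero.1 ((mul_eq_zero.1 h4).resolve_left (by linarith))
  ext1 j
  have := hn j.val
  rw [ZMod.natCast_zmod_val, h00] at this
  rw [this, ← Jop_apply]
  simp

/-- The kernel of the form `B` consists of the constant polygons. -/
theorem finrank_ker_shiftOp :
    Module.finrank ℝ (LinearMap.ker
      ((shiftOp k r - .id ℝ (VR k r) : VR k r →L[ℝ] VR k r) : VR k r →ₗ[ℝ] VR k r)) = 2 * k := by
  have hV : Module.finrank ℝ (V k) = 2 * k := by simp [V, two_mul]
  rw [← hV]
  let f : V k →ₗ[ℝ] VR k r :=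
    { toFun := fun v => WithLp.toLp 2 fun _ => v
      map_add' := fun a b => rfl
      map_smul' := fun s a => rfl }
  have hf : Function.Injective f := fun a b h => congrArg (fun z : VR k r => z 0) h
  rw [← LinearMap.finrank_range_of_inj hf]
  suffices h : LinearMap.ker
      ((shiftOp k r - .id ℝ (VR k r) : VR k r →L[ℝ] VR k r) : VR k r →ₗ[ℝ] VR k r) =
      LinearMap.range f by rw [h]
  ext z
  constructor
  · intro hz
    have hstep : ∀ j, z (j - 1) = z j := fun j =>
      congrArg (fun w : VR k r => w j) (sub_eq_zero.1 hz)
    have hn : ∀ n : ℕ, z (n : ZMod r) = z 0 := by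
      intro n
      induction n with
      | zero => simp
      | succ n ih => rw [← hstep, Nat.cast_succ, add_sub_cancel_right, ih]
    refine ⟨z 0, ?_⟩
    ext1 j
    have := hn j.val
    rw [ZMod.natCast_zmod_val] at this
    exact this.symm
  · rintro ⟨v, rfl⟩
    exact sub_self _

/-- If consecutive Lagrangian subspaces are close, then the shift almost preserves their product. -/
theorem norm_compl_shiftOp_le {L : ZMod r → Lagr k}
    (hL : ∀ j v, ‖(L j).proj v - (L (j - 1)).proj v‖ ≤ 1 / 2 * ‖v‖) (a : VR k r) :
    ‖shiftOp k r (diagOp (fun j => (L j).proj) a)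
      - diagOp (fun j => (L j).proj) (shiftOp k r (diagOp (fun j => (L j).proj) a))‖
      ≤ 1 / 2 * ‖a‖ := by
  refine (sq_le_sq₀ (norm_nonneg _) (by positivity)).1 ?_
  have hs : ∑ j, ‖a j‖ ^ 2 = ∑ j, ‖a (j - 1)‖ ^ 2 :=
    (Equiv.sum_comp (Equiv.subRight (1 : ZMod r)) fun j => ‖a j‖ ^ 2).symm
  rw [mul_pow, PiLp.norm_sq_eq_of_L2, PiLp.norm_sq_eq_of_L2, hs, Finset.mul_sum]
  refine Finset.sum_le_sum fun j _ => ?_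
  rw [← mul_pow]
  refine pow_le_pow_left₀ (norm_nonneg _) ?_ 2
  simp only [PiLp.sub_apply, shiftOp_apply, diagOp_apply]
  set b := (L (j - 1)).proj (a (j - 1)) with hb
  have h1 : (L (j - 1)).proj b = b := (L (j - 1)).isLagrProj.idem _
  have h2 := hL j b
  rw [h1, norm_sub_rev] at h2
  exact h2.trans (mul_le_mul_of_nonneg_left ((L (j - 1)).isLagrProj.norm_map_le _) (by norm_num))

/-- The comparison of the negative eigenbundles, for continuous families of slowly varying cyclic
sequences of Lagrangian subspaces. -/
theorem negEigenbundle_formA_formB {X : Type*} [TopologicalSpace X] (hr : 8 ≤ r)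
    {L : X → ZMod r → Lagr k} (hLc : ∀ j, Continuous fun x => L x j)
    (hL : ∀ x j v, ‖(L x j).proj v - (L x (j - 1)).proj v‖ ≤ 1 / 2 * ‖v‖) :
    IsSubbundle (fun x => negEigenspace (formA (L x))) ∧
    IsSubbundle (fun x => negEigenspace (formB (L x))) ∧
    BundleIso (fun x => negEigenspace (formA (L x)))
      (fun x => (negEigenspace (formB (L x))).prod
        (⊤ : Submodule ℝ (EuclideanSpace ℝ (Fin (2 * k))))) := by
  simp only [negEigenspace_formA, negEigenspace_formB]
  have hr' : (8 : ℝ) ≤ r := by exact_mod_cast hr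
  have hr0 : (0 : ℝ) < r := by linarith
  have hI : IsCplx (diagOp fun _ : ZMod r => Jop k) := isCplx_diagOp
  have hS : IsUnitaryFor (diagOp fun _ : ZMod r => Jop k) (shiftOp k r) := isUnitaryFor_shiftOp
  have hPc : Continuous fun x => diagOp fun j => (L x j).proj :=
    continuous_diagOp fun j => continuous_induced_dom.comp (hLc j)
  have hP := fun x => isLagrProj_diagOp (L x)
  have hclose := fun x => norm_compl_shiftOp_le (hL x)
  have hθ0 : (0 : ℝ) < 2 / r := by positivity
  have hθ : (2 : ℝ) / r ≤ 1 / 4 := by rw [div_le_iff₀ hr0]; linarith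
  have hA := continuous_starProjection_negSpace_hessOp hI hS hPc hP hclose ⟨hθ0.le, hθ⟩
  have hB := continuous_starProjection_negSpace_hessOp hI hS hPc hP hclose (θ := 0) (by simp)
  rw [rotOp_zero] at hB
  refine ⟨isSubbundle_of_continuous hA, isSubbundle_of_continuous hB, ?_⟩
  refine (bundleIso_sup_ker hI hS hPc hP hclose hθ0 hθ fun θ hθ v hv =>
    eq_zero_of_rotOp_eq hθ.1 ?_ hv).trans (bundleIso_sup_prod_top hB (fun x => ?_) ?_)
  · have := (le_div_iff₀ hr0).1 hθ.2
    linarith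
  · rw [← ker_hessOp hI (hP x) hS fun a => (hclose x a).trans (by nlinarith [norm_nonneg a])]
    exact isOrtho_negSpace_ker (hessOp_isSymmetric hI hS (hP x))
  · rw [finrank_ker_shiftOp, finrank_euclideanSpace, Fintype.card_fin]

end Reduction

/-! ### Loops of Lagrangian subspaces of bounded energy -/

section Energy

/-- Apart from the points of the subdivision, every point of `(0, 1)` is interior to one of the
intervals. -/
theorem Piecewise.exists_mem_Ioo {P : Set ℝ → Prop} (h : Piecewise P) :
    ∃ s : Set ℝ, s.Countable ∧ ∀ x ∈ Ioo (0 : ℝ) 1 \ s, ∃ a b, x ∈ Ioo a b ∧ P (Icc a b) := by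
  obtain ⟨m, t, h0, h1, hP⟩ := h
  refine ⟨range t, countable_range t, ?_⟩
  have key : ∀ n ≤ m, ∀ x, 0 < x → x ∉ range t → x < t n →
      ∃ i < m, x ∈ Ioo (t i) (t (i + 1)) := by
    intro n
    induction n with
    | zero => intro _ x hx _ hlt; rw [h0] at hlt; exact absurd hlt (not_lt.2 hx.le)
    | succ n ih =>
      intro hn x hx hne hlt
      rcases lt_trichotomy x (t n) with h | h | h
      · exact ih (by omega) x hx hne h
      · exact absurd ⟨n, h.symm⟩ hne
      · exact ⟨n, by omega, h, hlt⟩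
  rintro x ⟨hx, hne⟩
  obtain ⟨i, hi, hxi⟩ := key m le_rfl x hx.1 hne (by rw [h1]; exact hx.2)
  exact ⟨_, _, hxi, (hP i hi).2⟩

/-- The operator norm is bounded by the Hilbert-Schmidt norm. -/
theorem opNorm_sq_le_sum {k : ℕ} (A : V k →L[ℝ] V k) :
    ‖A‖ ^ 2 ≤ ∑ i, ‖A (EuclideanSpace.single i 1)‖ ^ 2 := by
  have h : ‖A‖ ≤ √(∑ i, ‖A (EuclideanSpace.single i 1)‖ ^ 2) := by
    refine A.opNorm_le_bound (Real.sqrt_nonneg _) fun v => ?_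
    have hv : v = ∑ i, v i • EuclideanSpace.single i (1 : ℝ) := by
      conv_lhs => rw [← (EuclideanSpace.basisFun (Fin k ⊕ Fin k) ℝ).sum_repr v]
      simp
    have h1 : ‖A v‖ ≤ ∑ i, ‖A (EuclideanSpace.single i 1)‖ * ‖v i‖ := by
      conv_lhs => rw [hv, map_sum]
      refine (norm_sum_le _ _).trans (Finset.sum_le_sum fun i _ => ?_)
      rw [map_smul, norm_smul, mul_comm]
    refine h1.trans ((Real.sum_mul_le_sqrt_mul_sqrt _ _ _).trans ?_)
    rw [EuclideanSpace.norm_eq v]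
  calc ‖A‖ ^ 2 ≤ √(∑ i, ‖A (EuclideanSpace.single i 1)‖ ^ 2) ^ 2 :=
        pow_le_pow_left₀ (norm_nonneg _) h 2
    _ = _ := Real.sq_sqrt (by positivity)

/-- By the inequality of Cauchy and Schwarz, the distance on a loop is bounded by the square root
of the energy and of the length of the parameter interval. -/
theorem enorm_proj_sub_le {k : ℕ} {l : C(UnitAddCircle, Lagr k)} (hl : LagrPiecewiseSmooth l)
    {C : ℝ≥0} (hC : lagrEnergy l < C) {a b : ℝ} (ha : 0 ≤ a) (hab : a ≤ b) (hb : b ≤ 1) :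
    ‖(l (b : UnitAddCircle)).proj - (l (a : UnitAddCircle)).proj‖ₑ ≤
      (2 * C * ENNReal.ofReal (b - a)) ^ (1 / 2 : ℝ) := by
  set f : ℝ → V k →L[ℝ] V k := fun t => (l (t : UnitAddCircle)).proj with hf
  have hfc : Continuous f :=
    continuous_induced_dom.comp (l.continuous.comp (AddCircle.continuous_mk' 1))
  have hmeas : AEStronglyMeasurable (deriv f) (volume.restrict (Ioc a b)) :=
    (stronglyMeasurable_deriv f).aestronglyMeasurable
  have hreal : ∀ {x s : ℝ}, 0 ≤ x → x ^ 2 ≤ s →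
      ENNReal.ofReal x ^ (2 : ℝ) ≤ 2 * ENNReal.ofReal (1 / 2 * s) := by
    intro x s hx h
    have h2 : ENNReal.ofReal 2 = 2 := by simp
    rw [← h2, ← ENNReal.ofReal_mul (by norm_num), ENNReal.ofReal_rpow_of_nonneg hx (by norm_num)]
    refine ENNReal.ofReal_le_ofReal ?_
    rw [Real.rpow_two]
    linarith
  have hsq : ∫⁻ t in Ioc a b, ‖deriv f t‖ₑ ^ (2 : ℝ) ≤ 2 * C := by
    calc ∫⁻ t in Ioc a b, ‖deriv f t‖ₑ ^ (2 : ℝ)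
        ≤ ∫⁻ t in Icc 0 1, ‖deriv f t‖ₑ ^ (2 : ℝ) := by
          refine lintegral_mono_set fun t ht => ⟨ha.trans ht.1.le, ht.2.trans hb⟩
      _ ≤ ∫⁻ t in Icc 0 1, 2 * ENNReal.ofReal ((1 / 2) * ∑ i,
            ‖deriv f t (EuclideanSpace.single i 1)‖ ^ 2) := by
          refine lintegral_mono fun t => ?_
          rw [← ofReal_norm]
          exact hreal (norm_nonneg _) (opNorm_sq_le_sum (deriv f t))
      _ = 2 * lagrEnergy l := by
          rw [lintegral_const_mul' _ _ (by simp)]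
          rfl
      _ ≤ 2 * C := by gcongr
  have hL1 : ∫⁻ t in Ioc a b, ‖deriv f t‖ₑ ≤ (2 * C * ENNReal.ofReal (b - a)) ^ (1 / 2 : ℝ) := by
    have h := ENNReal.lintegral_mul_le_Lp_mul_Lq (volume.restrict (Ioc a b))
      Real.HolderConjugate.two_two hmeas.enorm (aemeasurable_const (b := (1 : ℝ≥0∞)))
    simp only [Pi.mul_apply, mul_one, ENNReal.one_rpow, lintegral_const, one_mul,
      Measure.restrict_apply MeasurableSet.univ, univ_inter, Real.volume_Ioc] at h
    refine h.trans ?_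
    rw [ENNReal.mul_rpow_of_nonneg _ _ (by norm_num)]
    gcongr
  have hfin : (2 * C * ENNReal.ofReal (b - a)) ^ (1 / 2 : ℝ) < ⊤ :=
    ENNReal.rpow_lt_top_of_nonneg (by norm_num)
      (ENNReal.mul_ne_top (ENNReal.mul_ne_top (by simp) (by simp)) ENNReal.ofReal_ne_top)
  have hint : IntegrableOn (deriv f) (Ioc a b) := ⟨hmeas, hL1.trans_lt hfin⟩
  obtain ⟨s, hs, hpiece⟩ := hl.exists_mem_Ioo
  have hderiv : ∀ x ∈ Ioo a b \ s, HasDerivAt f (deriv f x) x := by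
    rintro x ⟨hx, hxs⟩
    obtain ⟨c, d, hcd, hsm⟩ := hpiece x ⟨⟨ha.trans_lt hx.1, hx.2.trans_le hb⟩, hxs⟩
    exact ((hsm.contDiffAt (Icc_mem_nhds hcd.1 hcd.2)).differentiableAt (by simp)).hasDerivAt
  have hFTC := integral_eq_of_hasDerivAt_off_countable_of_le f (deriv f) hab hs hfc.continuousOn
    hderiv ((intervalIntegrable_iff_integrableOn_Ioc_of_le hab).2 hint)
  change ‖f b - f a‖ₑ ≤ _
  rw [← hFTC, intervalIntegral.integral_of_le hab]
  exact (enorm_integral_le_lintegral_enorm _).trans hL1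

theorem coe_natCast_div {r : ℕ} [NeZero r] (n : ℕ) :
    ((((n : ZMod r).val : ℝ) / (r : ℝ) : ℝ) : UnitAddCircle) =
      (((n : ℝ) / (r : ℝ) : ℝ) : UnitAddCircle) := by
  have hr : (r : ℝ) ≠ 0 := Nat.cast_ne_zero.2 (NeZero.ne r)
  have e : (n : ℝ) / r = ((n : ZMod r).val : ℝ) / r + ((n / r : ℕ) : ℝ) := by
    rw [ZMod.val_natCast]
    field_simp
    exact_mod_cast (Nat.mod_add_div n r).symm.trans (by ring)
  have h : ((((n / r : ℕ) : ℝ) : ℝ) : UnitAddCircle) = 0 :=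
    (AddCircle.coe_eq_zero_iff 1).2 ⟨((n / r : ℕ) : ℤ), by rw [zsmul_one, Int.cast_natCast]⟩
  rw [e, AddCircle.coe_add, h, add_zero]

theorem norm_sampled_sub_le {k r : ℕ} [NeZero r] {l : C(UnitAddCircle, Lagr k)}
    (hl : LagrPiecewiseSmooth l) {C : ℝ≥0} (hC : lagrEnergy l < C) (hr : 8 * (C : ℝ) ≤ r)
    (j : ZMod r) (v : V k) :
    ‖(sampled r l j).proj v - (sampled r l (j - 1)).proj v‖ ≤ 1 / 2 * ‖v‖ := by
  have hr0 : (0 : ℝ) < r := Nat.cast_pos.2 (Nat.pos_of_ne_zero (NeZero.ne r))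
  set n := (j - 1).val with hn
  have hj : j = ((n + 1 : ℕ) : ZMod r) := by
    rw [Nat.cast_succ, hn, ZMod.natCast_zmod_val, sub_add_cancel]
  have h1 : sampled r l j = l ((((n + 1 : ℕ) : ℝ) / r : ℝ) : UnitAddCircle) := by
    rw [hj, sampled, coe_natCast_div]
  have h2 : sampled r l (j - 1) = l (((n : ℝ) / r : ℝ) : UnitAddCircle) := rfl
  have hnr : n + 1 ≤ r := ZMod.val_lt (j - 1)
  have h := enorm_proj_sub_le hl hC (a := (n : ℝ) / r) (b := ((n + 1 : ℕ) : ℝ) / r)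
    (by positivity) (by gcongr; simp) ((div_le_one hr0).2 (by exact_mod_cast hnr))
  have e : ((n + 1 : ℕ) : ℝ) / r - n / r = 1 / r := by push_cast; ring
  have h3 : (2 * (C : ℝ≥0∞) * ENNReal.ofReal (1 / r)) ^ (1 / 2 : ℝ) ≤ ENNReal.ofReal (1 / 2) := by
    have h4 : 2 * (C : ℝ≥0∞) * ENNReal.ofReal (1 / r) ≤ ENNReal.ofReal (1 / 4) := by
      rw [show (2 : ℝ≥0∞) * C = ENNReal.ofReal (2 * C) by
        rw [ENNReal.ofReal_mul (by norm_num)]; simp, ← ENNReal.ofReal_mul (by positivity)]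
      refine ENNReal.ofReal_le_ofReal ?_
      rw [mul_one_div, div_le_iff₀ hr0]
      linarith
    refine (ENNReal.rpow_le_rpow h4 (by norm_num)).trans ?_
    rw [ENNReal.ofReal_rpow_of_nonneg (by norm_num) (by norm_num), ← Real.sqrt_eq_rpow,
      show (1 / 4 : ℝ) = (1 / 2) ^ 2 by norm_num, Real.sqrt_sq (by norm_num)]
  rw [e] at h
  have h5 := h.trans h3
  rw [← h1, ← h2, ← ofReal_norm, ENNReal.ofReal_le_ofReal_iff (by norm_num)] at h5
  exact ((sampled r l j).proj - (sampled r l (j - 1)).proj).le_of_opNorm_le h5 v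

end Energy

/-! ### Short geodesics -/

section Geodesics

variable {d : ℕ} {N : Type*} [EMetricSpace N] [ChartedSpace (EuclideanSpace ℝ (Fin d)) N]
  [RiemannianBundle (fun x : N => TangentSpace 𝓘(ℝ, EuclideanSpace ℝ (Fin d)) x)]

theorem speed_congr {c c' : ℝ → N} {t : ℝ} (h : c' =ᶠ[𝓝 t] c) : speed d c' t = speed d c t := by
  unfold speed
  rw [h.mfderiv_eq]
  -- the norms are those of the tangent spaces at the equal points `c' t` and `c t`
  exact congrArg (fun y : N => ‖(show TangentSpace 𝓘(ℝ, EuclideanSpace ℝ (Fin d)) y from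
    mfderiv 𝓘(ℝ, ℝ) 𝓘(ℝ, EuclideanSpace ℝ (Fin d)) c t (1 : ℝ))‖ₑ) h.eq_of_nhds

theorem IsMinimalGeodesic.congr {c c' : ℝ → N} {x y : N} (h : IsMinimalGeodesic d c x y)
    (heq : EqOn c' c (Icc 0 1)) : IsMinimalGeodesic d c' x y := by
  obtain ⟨h1, h2, h3, h4⟩ := h
  refine ⟨h1.congr heq, (heq (by simp)).trans h2, (heq (by simp)).trans h3, fun t ht => ?_⟩
  rw [← h4 t ht]
  apply speed_congr
  filter_upwards [Icc_mem_nhds ht.1 ht.2] with s hs using heq hs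

theorem speed_comp_affine {c : ℝ → N} {a b t : ℝ}
    (hc : MDifferentiableAt 𝓘(ℝ, ℝ) 𝓘(ℝ, EuclideanSpace ℝ (Fin d)) c (a * t + b)) :
    speed d (fun u => c (a * u + b)) t = ‖a‖ₑ * speed d c (a * t + b) := by
  have h1 : HasDerivAt (fun u : ℝ => a * u + b) a t := by
    simpa using ((hasDerivAt_id t).const_mul a).add_const b
  have h2 := hc.hasMFDerivAt.comp t h1.hasFDerivAt.hasMFDerivAt
  unfold speed
  rw [show (fun u => c (a * u + b)) = c ∘ fun u => a * u + b from rfl, h2.mfderiv, ← enorm_smul]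
  congr 1
  refine Eq.trans ?_ (map_smul (mfderiv 𝓘(ℝ, ℝ) 𝓘(ℝ, EuclideanSpace ℝ (Fin d)) c (a * t + b)) a _)
  refine congrArg (mfderiv 𝓘(ℝ, ℝ) 𝓘(ℝ, EuclideanSpace ℝ (Fin d)) c (a * t + b)) ?_
  change (1 : ℝ) • a = a • (1 : ℝ)
  simp

/-- A choice of the geodesics between close points of `M`. -/
theorem ShortGeodesics.exists_choice {M W : Set N} {ρ : ℝ≥0∞} (h : ShortGeodesics d M W ρ) :
    ∃ G : N → N → ℝ → N, ∀ x ∈ M, ∀ y ∈ M, edist x y < ρ →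
      IsMinimalGeodesic d (G x y) x y ∧ MapsTo (G x y) (Icc 0 1) W ∧
      ∀ σ : ℝ → N, σ 0 = x → σ 1 = y →
        (∀ s ∈ Icc (0 : ℝ) 1, ∀ t ∈ Icc (0 : ℝ) 1,
          edist (σ s) (σ t) = ENNReal.ofReal |s - t| * edist x y) →
        EqOn σ (G x y) (Icc 0 1) := by
  classical
  refine ⟨fun x y => if hxy : x ∈ M ∧ y ∈ M ∧ edist x y < ρ then
    (h x hxy.1 y hxy.2.1 hxy.2.2).choose else fun _ => x, fun x hx y hy hlt => ?_⟩
  simp only [hx, hy, hlt, and_self, dite_true]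
  exact (h x hx y hy hlt).choose_spec

variable [IsRiemannianManifold 𝓘(ℝ, EuclideanSpace ℝ (Fin d)) N]

/-- A minimal geodesic realizes the distance between any two of its points: otherwise the triangle
inequality would make the distance of its endpoints too small. -/
theorem IsMinimalGeodesic.edist_eq {c : ℝ → N} {x y : N} (h : IsMinimalGeodesic d c x y)
    (hxy : edist x y ≠ ⊤) {s t : ℝ} (hs : s ∈ Icc (0 : ℝ) 1) (ht : t ∈ Icc (0 : ℝ) 1) :
    edist (c s) (c t) = ENNReal.ofReal |s - t| * edist x y := by
  obtain ⟨hc, h0, h1, hspeed⟩ := h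
  have hle : ∀ s t : ℝ, 0 ≤ s → s ≤ t → t ≤ 1 →
      edist (c s) (c t) ≤ ENNReal.ofReal (t - s) * edist x y := by
    intro s t h0s hst ht1
    rw [IsRiemannianManifold.out (I := 𝓘(ℝ, EuclideanSpace ℝ (Fin d))) (c s) (c t)]
    refine (riemannianEDist_le_pathELength (γ := c)
      ((hc.of_le (by simp)).mono (Icc_subset_Icc h0s ht1)) rfl rfl hst).trans ?_
    rw [pathELength_eq_lintegral_mfderiv_Ioo]
    refine (setLIntegral_mono (g := fun _ => edist x y) measurable_const fun u hu => ?_).trans ?_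
    · exact (hspeed u ⟨h0s.trans_lt hu.1, hu.2.trans_le ht1⟩).le
    · rw [setLIntegral_const, Real.volume_Ioo, mul_comm]
  wlog hst : s ≤ t generalizing s t
  · rw [edist_comm, abs_sub_comm]
    exact this ht hs (le_of_not_ge hst)
  rw [abs_sub_comm, abs_of_nonneg (by linarith)]
  refine le_antisymm (hle s t hs.1 hst ht.2) ?_
  have a1 := hle 0 s le_rfl hs.1 hs.2
  have a2 := hle t 1 ht.1 ht.2 le_rfl
  rw [h0, sub_zero] at a1
  rw [h1] at a2
  have hsum : ENNReal.ofReal s * edist x y + ENNReal.ofReal (t - s) * edist x y +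
      ENNReal.ofReal (1 - t) * edist x y = edist x y := by
    rw [← add_mul, ← add_mul, ← ENNReal.ofReal_add hs.1 (by linarith),
      ← ENNReal.ofReal_add (by linarith [hs.1]) (by linarith [ht.2])]
    rw [show s + (t - s) + (1 - t) = 1 by ring, ENNReal.ofReal_one, one_mul]
  have htri : edist x y ≤ ENNReal.ofReal s * edist x y + edist (c s) (c t) +
      ENNReal.ofReal (1 - t) * edist x y :=
    (edist_triangle4 x (c s) (c t) y).trans (by gcongr)
  have hfin : ∀ w : ℝ, ENNReal.ofReal w * edist x y ≠ ⊤ := fun w =>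
    ENNReal.mul_ne_top ENNReal.ofReal_ne_top hxy
  have h5 := hsum.le.trans htri
  rw [ENNReal.add_le_add_iff_right (hfin _), ENNReal.add_le_add_iff_left (hfin _)] at h5
  exact h5

/-- Short geodesics depend continuously on their endpoints. Since the geodesics run in a compact
neighbourhood of `M`, limits along ultrafilters exist, realize the distances, and are therefore
the geodesics between the limit points. -/
theorem continuousOn_geodesic {M W : Set N} {ρ : ℝ≥0∞} {G : N → N → ℝ → N}
    (hG : ∀ x ∈ M, ∀ y ∈ M, edist x y < ρ →
      IsMinimalGeodesic d (G x y) x y ∧ MapsTo (G x y) (Icc 0 1) W ∧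
      ∀ σ : ℝ → N, σ 0 = x → σ 1 = y →
        (∀ s ∈ Icc (0 : ℝ) 1, ∀ t ∈ Icc (0 : ℝ) 1,
          edist (σ s) (σ t) = ENNReal.ofReal |s - t| * edist x y) →
        EqOn σ (G x y) (Icc 0 1))
    {δ : ℝ≥0} (hK : IsCompact (Metric.cthickening δ M)) (hδ : δ ≤ ρ) :
    ContinuousOn (fun q : ℝ × (N × N) => G q.2.1 q.2.2 q.1)
      (Icc 0 1 ×ˢ {p | p.1 ∈ M ∧ p.2 ∈ M ∧ edist p.1 p.2 < δ}) := by
  set P : Set (N × N) := {p | p.1 ∈ M ∧ p.2 ∈ M ∧ edist p.1 p.2 < δ} with hP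
  have hGP : ∀ p ∈ P, IsMinimalGeodesic d (G p.1 p.2) p.1 p.2 := fun p hp =>
    (hG p.1 hp.1 p.2 hp.2.1 (hp.2.2.trans_le hδ)).1
  have hdist : ∀ p ∈ P, ∀ s ∈ Icc (0 : ℝ) 1, ∀ t ∈ Icc (0 : ℝ) 1,
      edist (G p.1 p.2 s) (G p.1 p.2 t) = ENNReal.ofReal |s - t| * edist p.1 p.2 :=
    fun p hp s hs t ht => (hGP p hp).edist_eq (ne_top_of_lt hp.2.2) hs ht
  refine continuousOn_prod_of_continuousOn_lipschitzOnWith _ δ (fun u hu p₀ hp₀ => ?_) ?_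
  · rw [ContinuousWithinAt, tendsto_iff_ultrafilter]
    intro U hU
    have hUP : ∀ᶠ p in (U : Filter (N × N)), p ∈ P := hU self_mem_nhdsWithin
    have hUp : Tendsto id (U : Filter (N × N)) (𝓝 p₀) := hU.trans nhdsWithin_le_nhds
    have hlim : ∀ s ∈ Icc (0 : ℝ) 1, ∃ w, Tendsto (fun p : N × N => G p.1 p.2 s) U (𝓝 w) := by
      intro s hs
      have hev : ∀ᶠ p in (U : Filter (N × N)), G p.1 p.2 s ∈ Metric.cthickening (δ : ℝ) M := by
        filter_upwards [hUP] with p hp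
        refine Metric.mem_cthickening_of_edist_le _ p.1 _ _ hp.1 ?_
        have h0 := hdist p hp s hs 0 (by simp)
        rw [(hGP p hp).2.1, sub_zero, abs_of_nonneg hs.1] at h0
        rw [h0, ENNReal.ofReal_coe_nnreal]
        calc _ ≤ 1 * edist p.1 p.2 := by
              gcongr
              exact ENNReal.ofReal_le_one.2 hs.2
          _ ≤ δ := by rw [one_mul]; exact hp.2.2.le
      obtain ⟨w, -, hw⟩ := isCompact_iff_ultrafilter_le_nhds.1 hK (U.map fun p : N × N => G p.1 p.2 s)
        (le_principal_iff.2 hev)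
      exact ⟨w, hw⟩
    have : Nonempty N := ⟨p₀.1⟩
    choose! σ hσ using hlim
    have hfst : Tendsto (fun p : N × N => p.1) U (𝓝 p₀.1) :=
      (continuous_fst.tendsto p₀).comp hUp
    have hsnd : Tendsto (fun p : N × N => p.2) U (𝓝 p₀.2) :=
      (continuous_snd.tendsto p₀).comp hUp
    have h0 : σ 0 = p₀.1 := by
      refine tendsto_nhds_unique (hσ 0 (by simp)) (hfst.congr' ?_)
      filter_upwards [hUP] with p hp using (hGP p hp).2.1.symm
    have h1 : σ 1 = p₀.2 := by
      refine tendsto_nhds_unique (hσ 1 (by simp)) (hsnd.congr' ?_)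
      filter_upwards [hUP] with p hp using (hGP p hp).2.2.1.symm
    have hd : ∀ s ∈ Icc (0 : ℝ) 1, ∀ t ∈ Icc (0 : ℝ) 1,
        edist (σ s) (σ t) = ENNReal.ofReal |s - t| * edist p₀.1 p₀.2 := by
      intro s hs t ht
      refine tendsto_nhds_unique ((hσ s hs).edist (hσ t ht)) (Tendsto.congr' ?_
        (ENNReal.Tendsto.const_mul (hfst.edist hsnd) (Or.inr ENNReal.ofReal_ne_top)))
      filter_upwards [hUP] with p hp using (hdist p hp s hs t ht).symm
    have := (hG p₀.1 hp₀.1 p₀.2 hp₀.2.1 (hp₀.2.2.trans_le hδ)).2.2 σ h0 h1 hd hu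
    rw [← this]
    exact hσ u hu
  · intro p hp s hs t ht
    change edist (G p.1 p.2 s) (G p.1 p.2 t) ≤ _
    rw [hdist p hp s hs t ht, edist_dist, Real.dist_eq, mul_comm]
    gcongr
    exact hp.2.2.le

end Geodesics

/-! ### Piecewise geodesic loops -/

section Polygons

variable {N : Type*} {r : ℕ}

/-- The concatenation of the curves `G (z j) (z (j + 1))`, parametrized by intervals of
length one. -/
noncomputable def polygon (G : N → N → ℝ → N) (z : ZMod r → N) (s : ℝ) : N :=
  G (z ⌊s⌋) (z (⌊s⌋ + 1)) (Int.fract s)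

theorem polygon_eq {G : N → N → ℝ → N} {z : ZMod r → N} (h0 : ∀ j, G (z j) (z (j + 1)) 0 = z j)
    (h1 : ∀ j, G (z j) (z (j + 1)) 1 = z (j + 1)) {n : ℤ} {s : ℝ} (hs : s ∈ Icc (n : ℝ) (n + 1)) :
    polygon G z s = G (z n) (z (n + 1)) (s - n) := by
  rcases hs.2.lt_or_eq with h | h
  · have hf : ⌊s⌋ = n := Int.floor_eq_iff.2 ⟨hs.1, h⟩
    rw [polygon, Int.fract, hf]
  · have hf : ⌊s⌋ = n + 1 := by rw [h]; exact_mod_cast Int.floor_intCast (n + 1)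
    rw [polygon, Int.fract, hf, h]
    push_cast
    rw [sub_self, h0, add_sub_cancel_left, h1]

theorem polygon_add_natCast (G : N → N → ℝ → N) (z : ZMod r → N) (s : ℝ) :
    polygon G z (s + r) = polygon G z s := by
  rw [polygon, Int.floor_add_natCast, Int.fract_add_natCast]
  simp [polygon]

/-- Every point of the circle lies on one of `r` intervals of length `1 / r`. -/
theorem exists_coe_add_div [NeZero r] (x : UnitAddCircle) :
    ∃ j : ℕ, ∃ u ∈ Icc (0 : ℝ) 1, x = ((((j : ℝ) + u) / (r : ℝ) : ℝ) : UnitAddCircle) := by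
  have hr : (0 : ℝ) < r := Nat.cast_pos.2 (Nat.pos_of_ne_zero (NeZero.ne r))
  obtain ⟨t, ht, rfl⟩ : ∃ t ∈ Ico (0 : ℝ) (0 + 1), (t : UnitAddCircle) = x := by
    have := AddCircle.coe_image_Ico_eq (1 : ℝ) 0
    exact (this.symm ▸ mem_univ x : x ∈ _)
  have h0 : 0 ≤ r * t := by have := ht.1; positivity
  refine ⟨⌊r * t⌋₊, r * t - ⌊r * t⌋₊, ⟨by linarith [Nat.floor_le h0],
    by linarith [Nat.lt_floor_add_one (r * t)]⟩, ?_⟩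
  congr 1
  field_simp
  ring

variable [EMetricSpace N]

theorem continuous_polygon {X : Type*} [TopologicalSpace X] {G : N → N → ℝ → N}
    {z : X → ZMod r → N} (hz : Continuous z) {P : Set (N × N)}
    (hzP : ∀ x j, (z x j, z x (j + 1)) ∈ P)
    (h0 : ∀ p ∈ P, G p.1 p.2 0 = p.1) (h1 : ∀ p ∈ P, G p.1 p.2 1 = p.2)
    (hG : ContinuousOn (fun q : ℝ × (N × N) => G q.2.1 q.2.2 q.1) (Icc 0 1 ×ˢ P)) :
    Continuous fun q : X × ℝ => polygon G (z q.1) q.2 := by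
  have hlf : LocallyFinite fun n : ℤ => Icc (n : ℝ) (n + 1) := by
    intro x
    refine ⟨Ioo (x - 1) (x + 1), Ioo_mem_nhds (by linarith) (by linarith),
      (finite_Icc (⌊x⌋ - 2) (⌊x⌋ + 2)).subset ?_⟩
    rintro n ⟨y, ⟨hy1, hy2⟩, hy3, hy4⟩
    have e1 := Int.floor_le x
    have e2 := Int.lt_floor_add_one x
    constructor
    · have : (⌊x⌋ : ℝ) - 2 < n + 1 := by linarith
      have : ⌊x⌋ - 2 < n + 1 := by exact_mod_cast this
      omega
    · have : (n : ℝ) < ⌊x⌋ + 2 := by linarith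
      have : n < ⌊x⌋ + 2 := by exact_mod_cast this
      omega
  refine (hlf.preimage_continuous (continuous_snd (X := X))).continuous ?_
    (fun n => isClosed_Icc.preimage continuous_snd) (fun n => ?_)
  · refine eq_univ_of_forall fun q => mem_iUnion.2 ⟨⌊q.2⌋, Int.floor_le _,
      (Int.lt_floor_add_one _).le⟩
  · have hc : ContinuousOn (fun q : X × ℝ => G (z q.1 n) (z q.1 (n + 1)) (q.2 - n))
        (Prod.snd ⁻¹' Icc (n : ℝ) (n + 1)) := by
      refine hG.comp (f := fun q : X × ℝ => (q.2 - (n : ℝ), (z q.1 n, z q.1 (n + 1)))) ?_ ?_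
      · exact ((continuous_snd.sub continuous_const).prodMk
          ((((continuous_apply _).comp hz).comp continuous_fst).prodMk
            (((continuous_apply _).comp hz).comp continuous_fst))).continuousOn
      · rintro q ⟨hq1, hq2⟩
        exact ⟨⟨by linarith, by linarith⟩, hzP q.1 n⟩
    refine hc.congr fun q hq => ?_
    exact polygon_eq (fun j => h0 _ (hzP q.1 j)) (fun j => h1 _ (hzP q.1 j)) hq

/-- A continuous family of cyclic concatenations, as a continuous map to the space of loops. -/
theorem exists_continuous_loops [NeZero r] {X : Type*} [TopologicalSpace X] {G : N → N → ℝ → N}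
    {z : X → ZMod r → N} (hz : Continuous z) {P : Set (N × N)}
    (hzP : ∀ x j, (z x j, z x (j + 1)) ∈ P)
    (h0 : ∀ p ∈ P, G p.1 p.2 0 = p.1) (h1 : ∀ p ∈ P, G p.1 p.2 1 = p.2)
    (hG : ContinuousOn (fun q : ℝ × (N × N) => G q.2.1 q.2.2 q.1) (Icc 0 1 ×ˢ P)) :
    ∃ γ : X → C(UnitAddCircle, N), Continuous γ ∧ ∀ x, ∀ j : ℕ, ∀ u ∈ Icc (0 : ℝ) 1,
      γ x ((((j : ℝ) + u) / (r : ℝ) : ℝ) : UnitAddCircle) =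
        G (z x (j : ZMod r)) (z x ((j + 1 : ℕ) : ZMod r)) u := by
  have hr : (r : ℝ) ≠ 0 := Nat.cast_ne_zero.2 (NeZero.ne r)
  have hper : ∀ x, Function.Periodic (fun t : ℝ => polygon G (z x) (r * t)) 1 := fun x t => by
    simp only [mul_add, mul_one, polygon_add_natCast]
  have hc := continuous_polygon hz hzP h0 h1 hG
  have hq : IsOpenQuotientMap (Prod.map (id : X → X) ((↑) : ℝ → UnitAddCircle)) :=
    IsOpenQuotientMap.id.prodMap QuotientAddGroup.isOpenQuotientMap_mk
  have hcl : Continuous fun q : X × UnitAddCircle => (hper q.1).lift q.2 := by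
    rw [← hq.continuous_comp_iff]
    exact hc.comp (continuous_fst.prodMk (continuous_const.mul continuous_snd))
  refine ⟨ContinuousMap.curry ⟨_, hcl⟩, ContinuousMap.continuous _, fun x j u hu => ?_⟩
  change polygon G (z x) (r * (((j : ℝ) + u) / r)) = _
  rw [mul_div_cancel₀ _ hr, polygon_eq (n := j) (fun i => h0 _ (hzP x i)) (fun i => h1 _ (hzP x i))
    ⟨by push_cast; linarith [hu.1], by push_cast; linarith [hu.2]⟩]
  simp

end Polygons

section PiecewiseGeodesics

variable {d : ℕ} {N : Type*} [EMetricSpace N] [ChartedSpace (EuclideanSpace ℝ (Fin d)) N]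
  [RiemannianBundle (fun x : N => TangentSpace 𝓘(ℝ, EuclideanSpace ℝ (Fin d)) x)]
  {r : ℕ} [NeZero r] {γ : C(UnitAddCircle, N)} {z : ZMod r → N}

theorem coe_eq_piece (γ : C(UnitAddCircle, N)) (j : ℕ) (t : ℝ) :
    γ (t : UnitAddCircle) =
      γ ((((j : ℝ) + ((r : ℝ) * t + -(j : ℝ))) / (r : ℝ) : ℝ) : UnitAddCircle) := by
  have hr : (r : ℝ) ≠ 0 := Nat.cast_ne_zero.2 (NeZero.ne r)
  congr 2
  field_simp
  ring

theorem IsPiecewiseGeodesic.piecewise_contMDiffOn (h : IsPiecewiseGeodesic d γ z) :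
    Piecewise fun s => ContMDiffOn 𝓘(ℝ, ℝ) 𝓘(ℝ, EuclideanSpace ℝ (Fin d)) ∞
      (fun t : ℝ => γ (t : UnitAddCircle)) s := by
  have hr : (0 : ℝ) < r := Nat.cast_pos.2 (Nat.pos_of_ne_zero (NeZero.ne r))
  refine ⟨r, fun i => (i : ℝ) / r, by simp, div_self hr.ne',
    fun i _ => ⟨by beta_reduce; gcongr; simp, ?_⟩⟩
  rw [funext (coe_eq_piece (r := r) γ i)]
  refine (h i).1.comp (f := fun t : ℝ => (r : ℝ) * t + -(i : ℝ)) ?_ ?_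
  · rw [contMDiffOn_iff_contDiffOn]
    fun_prop
  · intro t ht
    have h1 := (div_le_iff₀ hr).1 ht.1
    have h2 := (le_div_iff₀ hr).1 ht.2
    push_cast at h2
    exact ⟨by linarith, by linarith⟩

theorem IsPiecewiseGeodesic.speed_eq (h : IsPiecewiseGeodesic d γ z) (j : ℕ) {t : ℝ}
    (ht : t ∈ Ioo ((j : ℝ) / r) (((j + 1 : ℕ) : ℝ) / r)) :
    speed d (fun u : ℝ => γ (u : UnitAddCircle)) t =
      r * edist (z (j : ZMod r)) (z ((j + 1 : ℕ) : ZMod r)) := by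
  have hr : (0 : ℝ) < r := Nat.cast_pos.2 (Nat.pos_of_ne_zero (NeZero.ne r))
  have h1 := (div_lt_iff₀ hr).1 ht.1
  have h2 := (lt_div_iff₀ hr).1 ht.2
  push_cast at h2
  have hmem : (r : ℝ) * t + -(j : ℝ) ∈ Ioo (0 : ℝ) 1 := ⟨by linarith, by linarith⟩
  rw [funext (coe_eq_piece (r := r) γ j)]
  rw [speed_comp_affine (c := fun v : ℝ => γ ((((j : ℝ) + v) / (r : ℝ) : ℝ) : UnitAddCircle))
    (((h j).1.contMDiffAt (Icc_mem_nhds hmem.1 hmem.2)).mdifferentiableAt (by simp)),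
    (h j).2.2.2 _ hmem, Real.enorm_natCast]

/-- The energy of a piecewise geodesic loop. -/
theorem IsPiecewiseGeodesic.loopEnergy_eq (h : IsPiecewiseGeodesic d γ z) :
    loopEnergy d γ = (r : ℝ≥0∞) * ∑ j : ZMod r, edist (z j) (z (j + 1)) ^ 2 := by
  have hr : (0 : ℝ) < r := Nat.cast_pos.2 (Nat.pos_of_ne_zero (NeZero.ne r))
  have hr' : (r : ℝ≥0∞) ≠ 0 := Nat.cast_ne_zero.2 (NeZero.ne r)
  have hpiece : ∀ j : ℕ, ∫⁻ t in Ioc ((j : ℝ) / r) (((j + 1 : ℕ) : ℝ) / r),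
      speed d (fun u : ℝ => γ (u : UnitAddCircle)) t ^ 2 =
      r * edist (z (j : ZMod r)) (z ((j + 1 : ℕ) : ZMod r)) ^ 2 := by
    intro j
    rw [← restrict_Ioo_eq_restrict_Ioc, setLIntegral_congr_fun measurableSet_Ioo
      (g := fun _ => (r * edist (z (j : ZMod r)) (z ((j + 1 : ℕ) : ZMod r))) ^ 2)
      fun t ht => by rw [h.speed_eq j ht], setLIntegral_const, Real.volume_Ioo]
    have e : ((j + 1 : ℕ) : ℝ) / r - j / r = (r : ℝ)⁻¹ := by push_cast; ring
    rw [e, ENNReal.ofReal_inv_of_pos hr, ENNReal.ofReal_natCast, mul_pow, sq (r : ℝ≥0∞),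
      mul_right_comm, mul_assoc (r : ℝ≥0∞) (r : ℝ≥0∞),
      ENNReal.mul_inv_cancel hr' (ENNReal.natCast_ne_top r), mul_one]
  have hsum : ∀ n : ℕ, ∫⁻ t in Ioc (0 : ℝ) ((n : ℝ) / r),
      speed d (fun u : ℝ => γ (u : UnitAddCircle)) t ^ 2 =
      ∑ j ∈ Finset.range n, r * edist (z (j : ZMod r)) (z ((j + 1 : ℕ) : ZMod r)) ^ 2 := by
    intro n
    induction n with
    | zero => simp
    | succ n ih =>
      rw [Finset.sum_range_succ, ← ih, ← hpiece n, ← lintegral_union measurableSet_Ioc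
        (Ioc_disjoint_Ioc_of_le le_rfl), Ioc_union_Ioc_eq_Ioc (by positivity) (by gcongr; simp)]
  have h1 := hsum r
  rw [div_self hr.ne'] at h1
  rw [loopEnergy, ← restrict_Ioc_eq_restrict_Icc, h1, ← Finset.mul_sum]
  congr 1
  refine Finset.sum_bij (fun j _ => (j : ZMod r)) (fun _ _ => Finset.mem_univ _) ?_ ?_ ?_
  · intro a ha b hb hab
    have := congrArg ZMod.val hab
    rwa [ZMod.val_cast_of_lt (Finset.mem_range.1 ha), ZMod.val_cast_of_lt (Finset.mem_range.1 hb)]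
      at this
  · exact fun b _ => ⟨b.val, Finset.mem_range.2 (ZMod.val_lt b), ZMod.natCast_zmod_val b⟩
  · intro j _
    rw [Nat.cast_succ]

end PiecewiseGeodesics

section Existence

variable {d : ℕ} {N : Type*} [EMetricSpace N] [ChartedSpace (EuclideanSpace ℝ (Fin d)) N]
  [RiemannianBundle (fun x : N => TangentSpace 𝓘(ℝ, EuclideanSpace ℝ (Fin d)) x)]
  [IsRiemannianManifold 𝓘(ℝ, EuclideanSpace ℝ (Fin d)) N]

/-- For large `r`, the piecewise geodesic loops exist, are unique, depend continuously on their
vertices, and have the energy of the polygons. -/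
theorem exists_piecewiseGeodesic {M W : Set N} (hM : IsCompact M) {ρ : ℝ≥0∞} (hρ : 0 < ρ)
    (hgeo : ShortGeodesics d M W ρ) (β : ℝ≥0) :
    ∃ r₀ : ℕ, ∀ (r : ℕ) [NeZero r], r₀ ≤ r →
      ∃ γ : LoopApprox r β M → LoopsIn d W, Continuous γ ∧
        (∀ z l, IsPiecewiseGeodesic d l.1 z.1 ↔ l = γ z) ∧
        ∀ z, loopEnergy d (γ z).1 < β := by
  obtain ⟨G, hG⟩ := hgeo.exists_choice
  have : LocallyCompactSpace N :=
    Manifold.locallyCompact_of_finiteDimensional 𝓘(ℝ, EuclideanSpace ℝ (Fin d))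
  obtain ⟨ε, hε, hK⟩ := hM.exists_isCompact_cthickening
  -- the geodesics of length less than `δ` exist and do not leave a compact neighbourhood of `M`
  obtain ⟨δ, hδ0, hδρ, hδε⟩ : ∃ δ : ℝ≥0, 0 < δ ∧ (δ : ℝ≥0∞) ≤ ρ ∧ (δ : ℝ) ≤ ε := by
    obtain ⟨δ, h0, h1⟩ := ENNReal.lt_iff_exists_nnreal_btwn.1
      (lt_min hρ (ENNReal.ofReal_pos.2 hε))
    refine ⟨δ, by exact_mod_cast h0, (h1.trans_le (min_le_left _ _)).le, ?_⟩
    have h2 := (h1.trans_le (min_le_right _ _)).le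
    rw [← ENNReal.ofReal_coe_nnreal] at h2
    exact (ENNReal.ofReal_le_ofReal_iff hε.le).1 h2
  have hKδ : IsCompact (Metric.cthickening (δ : ℝ) M) :=
    hK.of_isClosed_subset Metric.isClosed_cthickening (Metric.cthickening_mono hδε M)
  have hcont := continuousOn_geodesic hG hKδ hδρ
  set P : Set (N × N) := {p | p.1 ∈ M ∧ p.2 ∈ M ∧ edist p.1 p.2 < δ} with hP
  have hGP : ∀ p ∈ P, IsMinimalGeodesic d (G p.1 p.2) p.1 p.2 := fun p hp =>
    (hG p.1 hp.1 p.2 hp.2.1 (hp.2.2.trans_le hδρ)).1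
  -- each edge satisfies `r * dist ^ 2 < β`, so that `β ≤ r * δ ^ 2` makes it shorter than `δ`
  refine ⟨⌈β / δ ^ 2⌉₊, fun r _ hr => ?_⟩
  have hzP : ∀ (z : LoopApprox r β M) (j : ZMod r), (z.1 j, z.1 (j + 1)) ∈ P := by
    rintro ⟨z, hzM, hz⟩ j
    refine ⟨hzM _, hzM _, ?_⟩
    by_contra hlt
    have h1 : (δ : ℝ≥0∞) ^ 2 ≤ ∑ j : ZMod r, edist (z j) (z (j + 1)) ^ 2 :=
      (pow_le_pow_left' (not_lt.1 hlt) 2).trans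
        (Finset.single_le_sum (f := fun j => edist (z j) (z (j + 1)) ^ 2)
          (fun _ _ => zero_le) (Finset.mem_univ j))
    have h2 : β ≤ r * δ ^ 2 := by
      have h3 : β / δ ^ 2 ≤ r := Nat.ceil_le.1 hr
      rwa [div_le_iff₀ (by positivity)] at h3
    have h4 : (β : ℝ≥0∞) ≤ r * (δ : ℝ≥0∞) ^ 2 := by exact_mod_cast h2
    exact absurd hz (not_lt.2 (h4.trans (by gcongr)))
  obtain ⟨γ, hγc, hγ⟩ := exists_continuous_loops (r := r)
    (z := fun z : LoopApprox r β M => z.1) continuous_subtype_val hzP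
    (fun p hp => (hGP p hp).2.1) (fun p hp => (hGP p hp).2.2.1) hcont
  have hnP : ∀ (z : LoopApprox r β M) (j : ℕ),
      (z.1 (j : ZMod r), z.1 ((j + 1 : ℕ) : ZMod r)) ∈ P := fun z j => by
    rw [Nat.cast_succ]
    exact hzP z j
  have hpg : ∀ z, IsPiecewiseGeodesic d (γ z) z.1 := fun z j =>
    (hGP _ (hnP z j)).congr fun u hu => hγ z j u hu
  have hW : ∀ z t, γ z t ∈ W := by
    intro z t
    obtain ⟨j, u, hu, rfl⟩ := exists_coe_add_div (r := r) t
    rw [hγ z j u hu]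
    obtain ⟨h1, h2, h3⟩ := hnP z j
    exact (hG _ h1 _ h2 (h3.trans_le hδρ)).2.1 hu
  have hE : ∀ z : LoopApprox r β M, loopEnergy d (γ z) =
      (r : ℝ≥0∞) * ∑ j : ZMod r, edist (z.1 j) (z.1 (j + 1)) ^ 2 := fun z => (hpg z).loopEnergy_eq
  refine ⟨fun z => ⟨γ z, (hpg z).piecewise_contMDiffOn, hW z⟩, ?_, fun z l => ⟨fun hl => ?_, ?_⟩,
    fun z => (hE z).trans_lt z.2.2⟩
  · refine continuous_induced_rng.2 (hγc.prodMk ?_)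
    simp only [hE]
    refine ENNReal.continuous_const_mul (ENNReal.natCast_ne_top r) |>.comp
      (continuous_finsetSum _ fun j _ => ?_)
    refine (ENNReal.continuous_pow 2).comp (Continuous.edist ?_ ?_)
    · exact (continuous_apply j).comp continuous_subtype_val
    · exact (continuous_apply (j + 1)).comp continuous_subtype_val
  · refine Subtype.ext (ContinuousMap.ext fun t => ?_)
    obtain ⟨j, u, hu, rfl⟩ := exists_coe_add_div (r := r) t
    obtain ⟨h1, h2, h3⟩ := hnP z j
    have hmin := hl j
    have := (hG _ h1 _ h2 (h3.trans_le hδρ)).2.2 _ hmin.2.1 hmin.2.2.1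
      (fun s hs t ht => hmin.edist_eq (ne_top_of_lt h3) hs ht) hu
    exact this.trans (hγ z j u hu).symm
  · rintro rfl
    exact hpg z

end Existence

end FiniteReduction

/-! ### The comparison of the eigenbundles -/

theorem mainTheorem9
    {d : ℕ} {N : Type*} [EMetricSpace N] [ChartedSpace (EuclideanSpace ℝ (Fin d)) N]
    [IsManifold 𝓘(ℝ, EuclideanSpace ℝ (Fin d)) ∞ N]
    [RiemannianBundle (fun x : N => TangentSpace 𝓘(ℝ, EuclideanSpace ℝ (Fin d)) x)]
    [IsContMDiffRiemannianBundle 𝓘(ℝ, EuclideanSpace ℝ (Fin d)) ∞ (EuclideanSpace ℝ (Fin d))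
      (fun x : N => TangentSpace 𝓘(ℝ, EuclideanSpace ℝ (Fin d)) x)]
    [IsRiemannianManifold 𝓘(ℝ, EuclideanSpace ℝ (Fin d)) N]
    (M W : Set N) (hM : IsCompact M)
    (ρ : ℝ≥0∞) (hρ : 0 < ρ) (hgeo : FiniteReduction.ShortGeodesics d M W ρ)
    (k : ℕ) (β C : ℝ≥0) :
    ∃ r₀ : ℕ, ∀ (r : ℕ) [NeZero r], r₀ ≤ r →
      ∃ γ : FiniteReduction.LoopApprox r β M → FiniteReduction.LoopsIn d W,
        (∀ z l, FiniteReduction.IsPiecewiseGeodesic d l.1 z.1 ↔ l = γ z) ∧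
        ∀ S : FiniteReduction.LoopsIn d W → C(UnitAddCircle, FiniteReduction.Lagr k),
          ContinuousOn S {l | FiniteReduction.loopEnergy d l.1 < β} →
          (∀ l, FiniteReduction.loopEnergy d l.1 < β →
            FiniteReduction.LagrPiecewiseSmooth (S l) ∧ FiniteReduction.lagrEnergy (S l) < C) →
          let ζ : FiniteReduction.LoopApprox r β M → Submodule ℝ (FiniteReduction.VR k r) :=
            fun z => FiniteReduction.negEigenspace
              (FiniteReduction.formA (FiniteReduction.sampled r (S (γ z))))
          let ζB : FiniteReduction.LoopApprox r β M → Submodule ℝ (FiniteReduction.VR k r) :=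
            fun z => FiniteReduction.negEigenspace
              (FiniteReduction.formB (FiniteReduction.sampled r (S (γ z))))
          FiniteReduction.IsSubbundle ζ ∧ FiniteReduction.IsSubbundle ζB ∧
            FiniteReduction.BundleIso ζ
              (fun z => (ζB z).prod (⊤ : Submodule ℝ (EuclideanSpace ℝ (Fin (2 * k))))) := by
  obtain ⟨r₁, h₁⟩ := FiniteReduction.exists_piecewiseGeodesic hM hρ hgeo β
  -- `8 ≤ r` makes the angle `2 / r` at most `1 / 4`, and `8 * C ≤ r` makes the distance
  -- `√(2 * C / r)` of consecutive Lagrangian subspaces at most `1 / 2`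
  refine ⟨max r₁ (max 8 ⌈8 * (C : ℝ)⌉₊), fun r _ hr => ?_⟩
  obtain ⟨γ, hγc, hγ, hE⟩ := h₁ r ((le_max_left _ _).trans hr)
  have hr₂ := (le_max_right _ _).trans hr
  refine ⟨γ, hγ, fun S hS hSe => ?_⟩
  have hSγ : Continuous fun z => S (γ z) := hS.comp_continuous hγc hE
  exact FiniteReduction.negEigenbundle_formA_formB ((le_max_left _ _).trans hr₂)
    (fun j => (continuous_eval_const _).comp hSγ)
    (fun z j v => FiniteReduction.norm_sampled_sub_le (hSe _ (hE z)).1 (hSe _ (hE z)).2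
      (Nat.ceil_le.1 ((le_max_right _ _).trans hr₂)) j v)
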